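/- Let $b,c$ be positive integers. In $\mathcal F=\mathbb{Q}(x_1,x_2)$ define $x_m$ for all $m\in\mathbb{Z}$ by $x_{m-1}x_{m+1}=x_m^b+1$ for $m$ odd and $x_{m-1}x_{m+1}=x_m^c+1$ for $m$ even, and let $\mathcal{A}(b,c)$ be the subring of $\mathcal F$ generated by all the $x_m$. An element $x\in\mathcal{A}(b,c)$ is *pointed* at $(a_1,a_2)\in\mathbb{Z}^2$ if $x=x_1^{-a_1}x_2^{-a_2}\sum_{p,q\ge 0}c(p,q)\,x_1^{bp}x_2^{cq}$ with integers $c(p,q)$, only finitely many of them nonzero, and $c(0,0)=1$. It is *greedy* at $(a_1,a_2)$ if, moreover, for all $(p,q)\in\mathbb{Z}_{\ge0}^2\setminus\{(0,0)\}$, $$c(p,q)=\max\left(\sum_{k=1}^p(-1)^{k-1}c(p-k,q)\binom{a_2-cq+k-1}{k},\ \sum_{k=1}^q(-1)^{k-1}c(p,q-k)\binom{a_1-bp+k-1}{k}\right),$$ where $\binom{a}{k}=0$ unless $0\le k\le a$, and an empty sum is $0$. For integers $m,n\ge0$, a *Dyck path* of type $m\times n$ is a lattice path from $(0,0)$ to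 $(m,n)$, with unit steps to the East and to the North, that never goes above the main diagonal joining $(0,0)$ and $(m,n)$. The *maximal* Dyck path $\mathcal{D}^{m\times n}$ is the unique one such that every lattice point of the rectangle $[0,m]\times[0,n]$ strictly above the path is also strictly above the main diagonal. Let $\mathcal{D}_1$ and $\mathcal{D}_2$ be the sets of horizontal and vertical edges of $\mathcal{D}=\mathcal{D}^{m\times n}$. The points $(0,0)$ and $(m,n)$ are regarded as the same point. For lattice points $A,B$ on $\mathcal{D}$, let $AB$ be the subpath of $\mathcal{D}$ that starts at $A$ and goes in the Northeast direction until it reaches $B$ (continuing from $(0,0)$ if $(m,n)$ is reached first); $AA$ is the whole closed path. Let $(AB)_1$ and $(AB)_2$ be the sets of horizontal and vertical edges of $AB$, and let $AB^\circ$ be the set of lattice points of $AB$ other than $A$ and $B$. For $S_1\subseteq\mathcal{D}_1$ and $S_2\subseteq\mathcal{D}_2$, the pair $(S_1,S_2)$ is *compatible* if for all $u\in S_1$ and $v\in S_2$, denoting by $E$ the left endpoint of $u$ and by $F$ the upper endpoint of $v$, there is $A\in EF^\circ$ such that $$|(AF)_1|=b\,|(AF)_2\cap S_2|\quad\text{or}\quad|(EA)_2|=c\,|(EA)_1\cap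 S_1|.$$ **Theorem.** For every $(a_1,a_2)\in\mathbb{Z}^2$ there is exactly one element $x[a_1,a_2]\in\mathcal{A}(b,c)$ that is greedy at $(a_1,a_2)$, and it is given by $$x[a_1,a_2]=x_1^{-a_1}x_2^{-a_2}\sum_{(S_1,S_2)}x_1^{b|S_2|}x_2^{c|S_1|},$$ where the sum is over all compatible pairs $(S_1,S_2)$ in $\mathcal{D}^{[a_1]_+\times[a_2]_+}$, and $[a]_+=\max(a,0)$. In particular, for all $p,q\ge0$, the coefficient $c(p,q)$ of $x[a_1,a_2]$ is the number of compatible pairs $(S_1,S_2)$ in $\mathcal{D}^{[a_1]_+\times[a_2]_+}$ with $|S_1|=q$ and $|S_2|=p$. -/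

import Mathlib

namespace GreedyRank2

/-! ### The rank 2 cluster algebra -/

/-- The field of rational functions in two variables with rational coefficients. -/
abbrev RatFun : Type := FractionRing (MvPolynomial (Fin 2) ℚ)

/-- The initial cluster variable `x₁`. -/
noncomputable def x₁ : RatFun := algebraMap (MvPolynomial (Fin 2) ℚ) RatFun (MvPolynomial.X 0)

/-- The initial cluster variable `x₂`. -/
noncomputable def x₂ : RatFun := algebraMap (MvPolynomial (Fin 2) ℚ) RatFun (MvPolynomial.X 1)

/-- `clusterFwd b c n` is the cluster variable `x_{n+1}`. -/
noncomputable def clusterFwd (b c : ℕ) : ℕ → RatFun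
  | 0 => x₁
  | 1 => x₂
  | n + 2 => (clusterFwd b c (n + 1) ^ (if Even n then c else b) + 1) / clusterFwd b c n

/-- `clusterBwd b c n` is the cluster variable `x_{2-n}`. -/
noncomputable def clusterBwd (b c : ℕ) : ℕ → RatFun
  | 0 => x₂
  | 1 => x₁
  | n + 2 => (clusterBwd b c (n + 1) ^ (if Even n then b else c) + 1) / clusterBwd b c n

/-- The cluster variable `x_m`, for `m ∈ ℤ`. -/
noncomputable def clusterVar (b c : ℕ) (m : ℤ) : RatFun :=
  if 1 ≤ m then clusterFwd b c (m - 1).toNat else clusterBwd b c (2 - m).toNat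

/-- The cluster algebra `𝒜(b,c)`: the subring generated by all the cluster variables. -/
noncomputable def clusterAlgebra (b c : ℕ) : Subring RatFun :=
  Subring.closure (Set.range (clusterVar b c))

/-- A quotient of two polynomials that are positive at `(1,1)`. -/
def PosAtOne (f : RatFun) : Prop :=
  ∃ p q : MvPolynomial (Fin 2) ℚ, 0 < MvPolynomial.eval (fun _ => (1 : ℚ)) p ∧
    0 < MvPolynomial.eval (fun _ => (1 : ℚ)) q ∧
    f = algebraMap _ RatFun p / algebraMap _ RatFun q

theorem algebraMap_ne_zero_of_pos {p : MvPolynomial (Fin 2) ℚ}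
    (h : 0 < MvPolynomial.eval (fun _ => (1 : ℚ)) p) : algebraMap _ RatFun p ≠ 0 := by
  intro h0
  have : p = 0 := (IsFractionRing.injective (MvPolynomial (Fin 2) ℚ) RatFun) (by simpa using h0)
  simp [this] at h

theorem PosAtOne.ne_zero {f : RatFun} (h : PosAtOne f) : f ≠ 0 := by
  obtain ⟨p, q, hp, hq, rfl⟩ := h
  exact div_ne_zero (algebraMap_ne_zero_of_pos hp) (algebraMap_ne_zero_of_pos hq)

theorem PosAtOne.step {f g : RatFun} (hf : PosAtOne f) (hg : PosAtOne g) (e : ℕ) :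
    PosAtOne ((f ^ e + 1) / g) := by
  obtain ⟨p, q, hp, hq, rfl⟩ := hf
  obtain ⟨r, s, hr, hs, rfl⟩ := hg
  refine ⟨(p ^ e + q ^ e) * s, q ^ e * r, ?_, ?_, ?_⟩
  · simp only [map_mul, map_add, map_pow]; positivity
  · simp only [map_mul, map_pow]; positivity
  · have h1 := algebraMap_ne_zero_of_pos hq
    have h2 := algebraMap_ne_zero_of_pos hr
    have h3 := algebraMap_ne_zero_of_pos hs
    simp only [map_mul, map_add, map_pow, div_pow]
    field_simp

theorem posAtOne_x₁ : PosAtOne x₁ := ⟨MvPolynomial.X 0, 1, by simp, by simp, by simp [x₁]⟩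

theorem posAtOne_x₂ : PosAtOne x₂ := ⟨MvPolynomial.X 1, 1, by simp, by simp, by simp [x₂]⟩

theorem posAtOne_clusterFwd (b c : ℕ) (n : ℕ) :
    PosAtOne (clusterFwd b c n) ∧ PosAtOne (clusterFwd b c (n + 1)) := by
  induction n with
  | zero => exact ⟨posAtOne_x₁, posAtOne_x₂⟩
  | succ n ih => exact ⟨ih.2, by rw [clusterFwd]; exact ih.2.step ih.1 _⟩

theorem posAtOne_clusterBwd (b c : ℕ) (n : ℕ) :
    PosAtOne (clusterBwd b c n) ∧ PosAtOne (clusterBwd b c (n + 1)) := by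
  induction n with
  | zero => exact ⟨posAtOne_x₂, posAtOne_x₁⟩
  | succ n ih => exact ⟨ih.2, by rw [clusterBwd]; exact ih.2.step ih.1 _⟩

/-- No division above is by zero, and the exchange relations hold for all `m ∈ ℤ`. -/
theorem clusterVar_exchange (b c : ℕ) (m : ℤ) :
    clusterVar b c (m - 1) * clusterVar b c (m + 1) =
      clusterVar b c m ^ (if Odd m then b else c) + 1 := by
  have hF : ∀ n, clusterFwd b c n * clusterFwd b c (n + 2) =
      clusterFwd b c (n + 1) ^ (if Even n then c else b) + 1 := fun n => by
    rw [clusterFwd, mul_div_cancel₀ _ (posAtOne_clusterFwd b c n).1.ne_zero]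
  have hB : ∀ n, clusterBwd b c n * clusterBwd b c (n + 2) =
      clusterBwd b c (n + 1) ^ (if Even n then b else c) + 1 := fun n => by
    rw [clusterBwd, mul_div_cancel₀ _ (posAtOne_clusterBwd b c n).1.ne_zero]
  have eF : ∀ n : ℕ, clusterVar b c (n + 1) = clusterFwd b c n := fun n => by
    rw [clusterVar, if_pos (by omega)]; congr 1; omega
  have eB : ∀ n : ℕ, clusterVar b c (2 - n) = clusterBwd b c n := fun n => by
    rcases n with _ | _ | n
    · simpa [clusterFwd, clusterBwd] using eF 1
    · simpa [clusterFwd, clusterBwd] using eF 0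
    · rw [clusterVar, if_neg (by push_cast; omega)]; congr 1; omega
  rcases le_or_gt 2 m with h | h
  · obtain ⟨n, rfl⟩ : ∃ n : ℕ, m = n + 2 := ⟨(m - 2).toNat, by omega⟩
    have e1 := eF n
    have e2 := eF (n + 1)
    have e3 := eF (n + 2)
    have p : Odd ((n : ℤ) + 2) ↔ ¬ Even n := by
      rw [← Int.not_even_iff_odd]; simp [parity_simps]
    rw [show (n : ℤ) + 2 - 1 = n + 1 by ring, e1,
      show (n : ℤ) + 2 + 1 = ((n + 2 : ℕ) : ℤ) + 1 by push_cast; ring, e3,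
      show (n : ℤ) + 2 = ((n + 1 : ℕ) : ℤ) + 1 by push_cast; ring, e2, hF]
    congr 2
    push_cast
    rw [show (n : ℤ) + 1 + 1 = n + 2 by ring]
    by_cases hn : Even n
    · rw [if_pos hn, if_neg (by rw [p]; simpa using hn)]
    · rw [if_neg hn, if_pos (by rw [p]; exact hn)]
  · obtain ⟨n, rfl⟩ : ∃ n : ℕ, m = 1 - n := ⟨(1 - m).toNat, by omega⟩
    have e1 := eB n
    have e2 := eB (n + 1)
    have e3 := eB (n + 2)
    have p : Odd ((1 : ℤ) - n) ↔ Even n := by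
      rw [← Int.not_even_iff_odd]; simp [Int.even_sub, Int.even_coe_nat]
    rw [show (1 : ℤ) - n - 1 = 2 - ((n + 2 : ℕ) : ℤ) by push_cast; ring, e3,
      show (1 : ℤ) - n + 1 = 2 - n by ring, e1, mul_comm, hB]
    rw [show (1 : ℤ) - n = 2 - ((n + 1 : ℕ) : ℤ) by push_cast; ring, e2]
    congr 2
    rw [show 2 - ((n + 1 : ℕ) : ℤ) = 1 - n by push_cast; ring]
    simp only [p]

/-! ### Pointed and greedy elements -/

/-- The binomial coefficient `a choose k` with the convention that it is zero unless
`0 ≤ k ≤ a`. -/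
def binom (a : ℤ) (k : ℕ) : ℤ := if (k : ℤ) ≤ a then (a.toNat.choose k : ℤ) else 0

/-- The element `x` of the cluster algebra is pointed at `(a₁,a₂)`, and
`x = x₁^{-a₁} x₂^{-a₂} ∑_{p,q ≥ 0} κ(p,q) x₁^{bp} x₂^{cq}` is its expansion. -/
def IsPointedWith (b c : ℕ) (a₁ a₂ : ℤ) (x : RatFun) (κ : ℕ × ℕ →₀ ℤ) : Prop :=
  x ∈ clusterAlgebra b c ∧
  x = x₁ ^ (-a₁) * x₂ ^ (-a₂) *
    κ.sum (fun pq n => (n : RatFun) * x₁ ^ (b * pq.1) * x₂ ^ (c * pq.2)) ∧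
  κ (0, 0) = 1

/-- The recurrence relation that defines greedy elements. -/
def GreedyRecurrence (b c : ℕ) (a₁ a₂ : ℤ) (κ : ℕ × ℕ →₀ ℤ) : Prop :=
  ∀ p q : ℕ, (p, q) ≠ (0, 0) →
    κ (p, q) = max
      (∑ k ∈ Finset.Icc 1 p, (-1) ^ (k - 1) * κ (p - k, q) * binom (a₂ - c * q + k - 1) k)
      (∑ k ∈ Finset.Icc 1 q, (-1) ^ (k - 1) * κ (p, q - k) * binom (a₁ - b * p + k - 1) k)

/-- The element `x` is greedy at `(a₁,a₂)`. -/
def IsGreedyAt (b c : ℕ) (a₁ a₂ : ℤ) (x : RatFun) : Prop :=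
  ∃ κ : ℕ × ℕ →₀ ℤ, IsPointedWith b c a₁ a₂ x κ ∧ GreedyRecurrence b c a₁ a₂ κ

/-! ### Maximal Dyck paths -/

/-- A lattice path from `(0,0)` to `(m,n)` with unit steps to the East and to the North, given by
its lattice points `pt 0, …, pt (m+n)`. The edge number `k : Fin (m + n)` joins `pt k` to
`pt (k+1)`. -/
@[ext]
structure LatticePath (m n : ℕ) where
  pt : Fin (m + n + 1) → ℕ × ℕ
  start : pt 0 = (0, 0)
  finish : pt (Fin.last (m + n)) = (m, n)
  step : ∀ k : Fin (m + n),
    pt k.succ = ((pt k.castSucc).1 + 1, (pt k.castSucc).2) ∨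
    pt k.succ = ((pt k.castSucc).1, (pt k.castSucc).2 + 1)

/-- The path never goes above the main diagonal joining `(0,0)` and `(m,n)`. -/
def LatticePath.IsDyck {m n : ℕ} (D : LatticePath m n) : Prop :=
  ∀ k, (D.pt k).2 * m ≤ (D.pt k).1 * n

/-- A Dyck path is maximal if any lattice point (of the rectangle) strictly above it is also
strictly above the main diagonal. -/
def LatticePath.IsMaximalDyck {m n : ℕ} (D : LatticePath m n) : Prop :=
  D.IsDyck ∧ ∀ x y : ℕ, x ≤ m → y ≤ n →
    (∀ k, (D.pt k).1 = x → (D.pt k).2 < y) → x * n < y * m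

/-- The lattice points of the maximal Dyck path: go to the North whenever this leads neither above
the main diagonal nor out of the rectangle, and to the East otherwise. -/
def maxDyckPoint (m n : ℕ) : ℕ → ℕ × ℕ
  | 0 => (0, 0)
  | k + 1 =>
    if (maxDyckPoint m n k).2 + 1 ≤ n ∧
        ((maxDyckPoint m n k).2 + 1) * m ≤ (maxDyckPoint m n k).1 * n then
      ((maxDyckPoint m n k).1, (maxDyckPoint m n k).2 + 1)
    else ((maxDyckPoint m n k).1 + 1, (maxDyckPoint m n k).2)

theorem maxDyckPoint_inv (m n k : ℕ) (hk : k ≤ m + n) :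
    (maxDyckPoint m n k).1 + (maxDyckPoint m n k).2 = k ∧ (maxDyckPoint m n k).1 ≤ m ∧
    (maxDyckPoint m n k).2 ≤ n ∧ (maxDyckPoint m n k).2 * m ≤ (maxDyckPoint m n k).1 * n := by
  induction k with
  | zero => simp [maxDyckPoint]
  | succ k ih =>
    obtain ⟨h1, h2, h3, h4⟩ := ih (by omega)
    rw [maxDyckPoint]
    split_ifs with h
    · exact ⟨by simp; omega, h2, h.1, h.2⟩
    · refine ⟨by simp; omega, ?_, h3, ?_⟩
      · change (maxDyckPoint m n k).1 + 1 ≤ m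
        by_contra hx
        have hx' : (maxDyckPoint m n k).1 = m := by omega
        refine h ⟨by omega, ?_⟩
        rw [hx', mul_comm m n]
        exact Nat.mul_le_mul_right m (by omega)
      · change (maxDyckPoint m n k).2 * m ≤ ((maxDyckPoint m n k).1 + 1) * n
        exact h4.trans (Nat.mul_le_mul_right n (by omega))

/-- The maximal Dyck path of type `m × n`. -/
def maxDyckPath (m n : ℕ) : LatticePath m n where
  pt k := maxDyckPoint m n k
  start := rfl
  finish := by
    obtain ⟨h1, h2, h3, -⟩ := maxDyckPoint_inv m n (m + n) le_rfl
    simp only [Fin.val_last]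
    ext <;> simp <;> omega
  step k := by
    simp only [Fin.val_succ, Fin.val_castSucc]
    rw [maxDyckPoint]
    split_ifs
    · exact Or.inr rfl
    · exact Or.inl rfl

theorem isMaximalDyck_maxDyckPath (m n : ℕ) : (maxDyckPath m n).IsMaximalDyck := by
  refine ⟨fun k => (maxDyckPoint_inv m n k (by omega)).2.2.2, fun x y hx hy h => ?_⟩
  by_contra hlt
  have hpt : ∀ k, k ≤ m + n → (maxDyckPoint m n k).1 = x → (maxDyckPoint m n k).2 < y :=
    fun k hk => h ⟨k, by omega⟩
  -- a path that never gets to height `y` in column `x` never leaves that column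
  have key : ∀ k, k ≤ m + n → (maxDyckPoint m n k).1 ≤ x := by
    intro k
    induction k with
    | zero => intro _; simp [maxDyckPoint]
    | succ k ih =>
      intro hk
      have h0 := ih (by omega)
      have h5 := hpt k (by omega)
      rw [maxDyckPoint]
      split_ifs with hs
      · exact h0
      · change (maxDyckPoint m n k).1 + 1 ≤ x
        by_contra hc
        have hxk : (maxDyckPoint m n k).1 = x := by omega
        have h6 := h5 hxk
        refine hs ⟨by omega, ?_⟩
        rw [hxk]
        exact (Nat.mul_le_mul_right m (show _ ≤ y by omega)).trans (not_lt.mp hlt)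
  have hend : maxDyckPoint m n (m + n) = (m, n) := (maxDyckPath m n).finish
  have h7 := key (m + n) le_rfl
  have h8 := hpt (m + n) le_rfl
  rw [hend] at h7 h8
  have := h8 (le_antisymm h7 hx)
  simp only at this
  omega

theorem LatticePath.mono {m n : ℕ} (D : LatticePath m n) : Monotone D.pt :=
  Fin.monotone_iff_le_succ.mpr fun k => by
    rcases D.step k with h | h <;> rw [h] <;> constructor <;> simp

/-- The maximal Dyck path is the only path with the defining property. -/
theorem eq_maxDyckPath {m n : ℕ} (D : LatticePath m n) (hD : D.IsMaximalDyck) :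
    D = maxDyckPath m n := by
  have key : ∀ P Q : LatticePath m n, P.IsDyck → Q.IsMaximalDyck → ∀ k : Fin (m + n),
      P.pt k.castSucc = Q.pt k.castSucc →
      P.pt k.succ = ((P.pt k.castSucc).1, (P.pt k.castSucc).2 + 1) →
      Q.pt k.succ = ((Q.pt k.castSucc).1 + 1, (Q.pt k.castSucc).2) → False := by
    intro P Q hP hQ k h0 h1 h2
    have hle : P.pt k.succ ≤ P.pt (Fin.last _) := P.mono (Fin.le_last _)
    rw [P.finish, h1] at hle
    have h3 := hP k.succ
    rw [h1] at h3
    refine absurd (hQ.2 _ _ hle.1 hle.2 fun j hj => ?_) (not_lt.mpr h3)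
    simp only at hj ⊢
    rw [h0] at hj ⊢
    rcases le_or_gt j k.castSucc with hjk | hjk
    · have := (Q.mono hjk).2
      omega
    · have hjk' : k.succ ≤ j := Fin.castSucc_lt_iff_succ_le.mp hjk
      have := (Q.mono hjk').1
      rw [h2] at this
      simp only at this
      omega
  have hM := isMaximalDyck_maxDyckPath m n
  ext1
  funext k
  induction k using Fin.induction with
  | zero => rw [D.start, (maxDyckPath m n).start]
  | succ k ih =>
    rcases D.step k with h | h <;> rcases (maxDyckPath m n).step k with h' | h'
    · rw [h, h', ih]
    · exact (key _ _ hM.1 hD k ih.symm h' h).elim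
    · exact (key _ _ hD.1 hM k ih h h').elim
    · rw [h, h', ih]

/-! ### Compatible pairs -/

namespace LatticePath

variable {m n : ℕ}

/-- The set of horizontal edges of the path. -/
def horiz (D : LatticePath m n) : Finset (Fin (m + n)) :=
  {k | (D.pt k.succ).1 = (D.pt k.castSucc).1 + 1}

/-- The set of vertical edges of the path. -/
def vert (D : LatticePath m n) : Finset (Fin (m + n)) :=
  {k | (D.pt k.succ).2 = (D.pt k.castSucc).2 + 1}

end LatticePath

/-! The two ends `pt 0` and `pt (m+n)` of the path are regarded as the same point; so the points of
a path with `N` edges are numbered by `Fin N`, and the edge `k` goes from the point `k` to the point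
`k + 1` modulo `N`. -/

/-- The number of the point at which the edge `k` ends. -/
def endpoint {N : ℕ} (k : Fin N) : Fin N :=
  ⟨((k : ℕ) + 1) % N, Nat.mod_lt _ (Nat.zero_lt_of_lt k.isLt)⟩

/-- The edges of the subpath `AB`, which starts at `A` and goes in the Northeast direction until it
reaches `B`, continuing from `(0,0)` if it reaches the end of the path first; `AA` is the whole
path. -/
def subpath {N : ℕ} (A B : Fin N) : Finset (Fin N) :=
  {k | if A < B then A ≤ k ∧ k < B else A ≤ k ∨ k < B}

/-- The points of the subpath `AB` other than `A` and `B`. -/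
def innerPoints {N : ℕ} (A B : Fin N) : Finset (Fin N) :=
  {k | if A < B then A < k ∧ k < B else A < k ∨ k < B}

/-- Compatibility of a set `S₁` of horizontal edges and a set `S₂` of vertical edges of `D`. -/
def Compatible (b c : ℕ) {m n : ℕ} (D : LatticePath m n) (S₁ S₂ : Finset (Fin (m + n))) : Prop :=
  ∀ u ∈ S₁, ∀ v ∈ S₂, ∃ A ∈ innerPoints u (endpoint v),
    (subpath A (endpoint v) ∩ D.horiz).card = b * (subpath A (endpoint v) ∩ D.vert ∩ S₂).card ∨
    (subpath u A ∩ D.vert).card = c * (subpath u A ∩ D.horiz ∩ S₁).card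

instance (b c : ℕ) {m n : ℕ} (D : LatticePath m n) (S₁ S₂ : Finset (Fin (m + n))) :
    Decidable (Compatible b c D S₁ S₂) := by
  unfold Compatible; infer_instance

/-- The set of all compatible pairs `(S₁,S₂)` in `D`. -/
def compatiblePairs (b c : ℕ) {m n : ℕ} (D : LatticePath m n) :
    Finset (Finset (Fin (m + n)) × Finset (Fin (m + n))) :=
  {S ∈ D.horiz.powerset ×ˢ D.vert.powerset | Compatible b c D S.1 S.2}

end GreedyRank2

namespace GreedyRank2

open Finset

/-! ### Shadows in quasi-periodic integer walks -/

/-! Write `m = [a₁]₊`, `n = [a₂]₊`. A pair `(S₁,S₂)` is encoded by two quasi-periodic walks on the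
universal cover of the closed path: `f` (`walk₁`) goes down by 1 on vertical edges and up by `c` on
`S₁`; `g` (`walk₂`) goes up by 1 on horizontal edges and down by `b` on `S₂`. Compatibility says
that between an ascent of `f` and a later descent of `g`, either `f` returns to its level before the
ascent or `g` is already at its level after the descent. The shadow of `S₁` consists of the vertical
edges that start above a level of `f` attained less than a period earlier; the shadow of `S₂` is the
mirror image.

By a cycle lemma (`sum_unshadowed`), exactly `[n - c|S₁|]₊` vertical edges are unshadowed, and by
`walkCompat_congr` the unshadowed edges of `S₂` do not affect compatibility. So for fixed `|S₁| = q`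
the generating function of `|S₂|` is `(1+X)^[n-cq]₊` times that of the pairs with `S₂` inside the
shadow of `S₁`; the same holds with the roles exchanged. Inverting these powers, `c(p,q)` minus
either argument of the maximum counts the pairs of one of the two shadowed kinds. Both differences
are therefore nonnegative, and the recurrence says that for `(p,q) ≠ (0,0)` the two kinds do not
both occur.

That is a comparison of weights. If `S₂` lies in the shadow of a nonempty `S₁`, then `n|sh S₂| <
m|sh S₁|` (`sum_shadowWeight_pos`); the other kind gives the opposite strict inequality
(`sum_shadowWeight_neg`). Shadow sizes depend only on `|S₁|` and `|S₂|`, so the two clash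
(`eq_zero_of_shadowed`). To prove the inequality, `f` is cut into excursions above its running
minimum, and the weight of each is bounded by the change of height relative to the diagonal, which
maximality of the Dyck path controls.

The same divisibility of rows and columns puts the sum in the integral span of the `standardPoly`s,
that is, of monomials in `x₀, x₁, x₂, x₃`, hence in the cluster algebra. Uniqueness holds because
the recurrence determines every coefficient from `c(0,0) = 1`. -/

/-- The step `k → k + 1` of the walk `f` lies in the shadow of an earlier ascent, at distance less
than the period `N`. -/
def Shadowed (N : ℕ) (f : ℤ → ℤ) (k : ℤ) : Prop := ∃ j, k - N < j ∧ j ≤ k ∧ f j < f k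

/-- The step `k → k + 1` of the walk `g` lies in the shadow of a later descent, at distance less
than the period `N`. -/
def ShadowedR (N : ℕ) (g : ℤ → ℤ) (k : ℤ) : Prop := ∃ j, k < j ∧ j ≤ k + N ∧ g j < g (k + 1)

/-- Step `k` of the reversed walk traverses the edge `-k - 1` backwards. Reversal exchanges the two
kinds of shadow, so each argument is needed for one kind only. -/
theorem shadowed_comp_neg {N : ℕ} {g : ℤ → ℤ} {k : ℤ} :
    Shadowed N (fun i => g (-i)) k ↔ ShadowedR N g (-k - 1) := by
  constructor
  · rintro ⟨j, h1, h2, h3⟩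
    exact ⟨-j, by omega, by omega, by simpa using h3⟩
  · rintro ⟨j, h1, h2, h3⟩
    exact ⟨-j, by omega, by omega, by simpa using h3⟩

theorem shadowedR_comp_neg {N : ℕ} {f : ℤ → ℤ} {k : ℤ} :
    ShadowedR N (fun i => f (-i)) k ↔ Shadowed N f (-k - 1) := by
  have e : -(k + 1) = -k - 1 := by ring
  constructor
  · rintro ⟨j, h1, h2, h3⟩
    exact ⟨-j, by omega, by omega, by simpa [e] using h3⟩
  · rintro ⟨j, h1, h2, h3⟩
    exact ⟨-j, by omega, by omega, by simpa [e] using h3⟩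

theorem Shadowed.add_period {N : ℕ} {f : ℤ → ℤ} {T : ℤ} (hT : ∀ k, f (k + N) = f k + T) (k : ℤ) :
    Shadowed N f (k + N) ↔ Shadowed N f k := by
  constructor
  · rintro ⟨j, h1, h2, h3⟩
    have := hT (j - N)
    rw [sub_add_cancel] at this
    exact ⟨j - N, by omega, by omega, by have := hT k; omega⟩
  · rintro ⟨j, h1, h2, h3⟩
    exact ⟨j + N, by omega, by omega, by rw [hT, hT]; omega⟩

theorem ShadowedR.add_period {N : ℕ} {g : ℤ → ℤ} {T : ℤ} (hT : ∀ k, g (k + N) = g k + T) (k : ℤ) :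
    ShadowedR N g (k + N) ↔ ShadowedR N g k := by
  have e : k + N + 1 = k + 1 + N := by ring
  constructor
  · rintro ⟨j, h1, h2, h3⟩
    have h4 := hT (j - N)
    rw [sub_add_cancel] at h4
    rw [e, hT] at h3
    exact ⟨j - N, by omega, by omega, by omega⟩
  · rintro ⟨j, h1, h2, h3⟩
    exact ⟨j + N, by omega, by omega, by rw [e, hT, hT]; omega⟩

open Classical in
/-- A version of the cycle lemma: the number of descents in a period that are not shadowed. -/
theorem sum_unshadowed {N : ℕ} (hN : 0 < N) {f : ℤ → ℤ} {T : ℤ} (hT : ∀ k, f (k + N) = f k + T)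
    (hf : ∀ k, f k - 1 ≤ f (k + 1)) :
    ∑ i ∈ range N, (if f (i + 1) < f i ∧ ¬ Shadowed N f i then (1 : ℤ) else 0) = max (-T) 0 := by
  have hw : ∀ k, f (k + 1 - N) = f (k + 1) - T := fun k => by
    have := hT (k + 1 - N)
    rw [sub_add_cancel] at this
    omega
  rcases le_or_gt 0 T with h | h
  · rw [max_eq_right (by omega)]
    refine Finset.sum_eq_zero fun i _ => if_neg ?_
    rintro ⟨h1, h2⟩
    -- With nonnegative drift, one period before its end a descent has a point no higher than that
    -- end, which shadows it.
    exact h2 ⟨i + 1 - N, by omega, by omega, by rw [hw]; omega⟩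
  · rw [max_eq_left (by omega)]
    have hne : ∀ k : ℤ, (Ioc (k - N) k).Nonempty := fun k => ⟨k, by simp; omega⟩
    -- The minimum over the last `N` points drops, by exactly one, precisely at the unshadowed
    -- descents; the count telescopes to `M 0 - M N = -T`.
    set M : ℤ → ℤ := fun k => (Ioc (k - N) k).inf' (hne k) f with hM
    have hMle : ∀ k j : ℤ, k - N < j → j ≤ k → M k ≤ f j := fun k j h1 h2 =>
      inf'_le _ (mem_Ioc.2 ⟨h1, h2⟩)
    have hMex : ∀ k : ℤ, ∃ j, k - N < j ∧ j ≤ k ∧ M k = f j := fun k => by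
      obtain ⟨j, hj, h⟩ := exists_mem_eq_inf' (hne k) f
      exact ⟨j, (mem_Ioc.1 hj).1, (mem_Ioc.1 hj).2, h⟩
    have hMs : ∀ k, M (k + 1) = min (M k) (f (k + 1)) := fun k => by
      apply le_antisymm
      · refine le_min ?_ (hMle _ _ (by omega) le_rfl)
        obtain ⟨j, h1, h2, h3⟩ := hMex k
        rw [h3]
        -- The point that leaves the window lies above the one that enters, since `T < 0`.
        rcases eq_or_ne j (k + 1 - N) with rfl | h4
        · have := hMle (k + 1) (k + 1) (by omega) le_rfl
          rw [hw]; omega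
        · exact hMle _ _ (by omega) (by omega)
      · obtain ⟨j, h1, h2, h3⟩ := hMex (k + 1)
        rw [h3]
        rcases eq_or_ne j (k + 1) with rfl | h4
        · exact min_le_right _ _
        · exact (min_le_left _ _).trans (hMle _ _ (by omega) (by omega))
    have hMN : M (0 + N) = M 0 + T := by
      apply le_antisymm
      · obtain ⟨j, h1, h2, h3⟩ := hMex 0
        rw [h3, ← hT]
        exact hMle _ _ (by omega) (by omega)
      · obtain ⟨j, h1, h2, h3⟩ := hMex (0 + N)
        have h4 := hT (j - N)
        rw [sub_add_cancel] at h4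
        rw [h3, h4]
        have := hMle 0 (j - N) (by omega) (by omega)
        omega
    have hstep : ∀ k, (if f (k + 1) < f k ∧ ¬ Shadowed N f k then (1 : ℤ) else 0)
        = M k - M (k + 1) := fun k => by
      have h1 := hf k
      have h2 := hMle k k (by omega) le_rfl
      rw [hMs]
      split_ifs with hc
      · obtain ⟨h3, h4⟩ := hc
        have h5 : f k ≤ M k := by
          obtain ⟨j, h6, h7, h8⟩ := hMex k
          by_contra h9
          exact h4 ⟨j, h6, h7, by omega⟩
        rw [min_eq_right (by omega)]; omega
      · have h5 : M k ≤ f (k + 1) := by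
          by_contra h6
          refine hc ⟨by omega, ?_⟩
          rintro ⟨j, h7, h8, h9⟩
          have := hMle k j h7 h8
          omega
        rw [min_eq_left h5]; omega
    simp_rw [hstep]
    have := Finset.sum_range_sub' (fun i : ℕ => M i) N
    push_cast at this
    rw [this, ← zero_add (N : ℤ), hMN]
    ring

/-- Every ascent `u` of `f` and every later descent `v` of `g`, at distance less than the period,
are separated by a point at which `f` or `g` has returned to the appropriate level. -/
def WalkCompat (N : ℕ) (f g : ℤ → ℤ) : Prop :=
  ∀ u v, f u < f (u + 1) → g (v + 1) < g v → u < v → v < u + N →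
    ∃ A, u < A ∧ A ≤ v ∧ (f A = f u ∨ g A = g (v + 1))

theorem WalkCompat.reverse {N : ℕ} {f g : ℤ → ℤ} (h : WalkCompat N f g) :
    WalkCompat N (fun i => g (-i)) (fun i => f (-i)) := by
  intro u v hu hv h1 h2
  have e : ∀ k : ℤ, -(k + 1) + 1 = -k := fun k => by ring
  obtain ⟨A, h3, h4, h5⟩ := h (-(v + 1)) (-(u + 1)) (by rw [e]; exact hv)
    (by rw [e]; exact hu) (by omega) (by omega)
  rw [e] at h5
  exact ⟨-A, by omega, by omega, by simpa using h5.symm⟩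

theorem walkCompat_reverse_iff {N : ℕ} {f g : ℤ → ℤ} :
    WalkCompat N (fun i => g (-i)) (fun i => f (-i)) ↔ WalkCompat N f g :=
  ⟨fun h => by simpa using h.reverse, WalkCompat.reverse⟩

/-- The descents of `g` that are not in the shadow of ascents of `f` are irrelevant to
compatibility. -/
theorem walkCompat_congr {N : ℕ} {f g g' : ℤ → ℤ} (hf : ∀ k, f k - 1 ≤ f (k + 1))
    (hgg' : ∀ k, (f (k + 1) < f k → Shadowed N f k) → g (k + 1) - g k = g' (k + 1) - g' k)
    (hdes : ∀ k, g' (k + 1) < g' k ↔ g (k + 1) < g k ∧ Shadowed N f k) :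
    WalkCompat N f g ↔ WalkCompat N f g' := by
  -- As `f` descends by at most one, it cannot get to the level `f u` or below without visiting that
  -- level.
  have key : ∀ u v : ℤ, f u < f (u + 1) → v < u + N →
      (∃ A, u < A ∧ A ≤ v ∧ f A = f u) ∨ ∀ A, u < A → A ≤ v → f u < f A := by
    intro u v hu hv
    by_contra! hcon
    obtain ⟨h1, A, h2, h3, h4⟩ := hcon
    have h5 : ∀ i : ℕ, u + 1 + i ≤ v → f u < f (u + 1 + i) := by
      intro i
      induction i with
      | zero => intro _; simpa using hu
      | succ i ih =>
        intro hi
        push_cast at hi ⊢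
        have h6 := ih (by omega)
        have h7 := hf (u + 1 + i)
        have h8 := h1 (u + 1 + i + 1) (by omega) (by omega)
        rw [show u + 1 + ((i : ℤ) + 1) = u + 1 + i + 1 by ring]
        omega
    have := h5 (A - u - 1).toNat (by omega)
    rw [show u + 1 + ((A - u - 1).toNat : ℤ) = A by omega] at this
    omega
  -- While `f` stays above `f u`, every step is shadowed with witness `u`, so `g` and `g'` have the
  -- same increments there.
  have key' : ∀ u v : ℤ, u < v → v < u + N → (∀ A : ℤ, u < A → A ≤ v → f u < f A) →
      Shadowed N f v ∧ ∀ A : ℤ, u < A → A ≤ v → (g A = g (v + 1) ↔ g' A = g' (v + 1)) := by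
    intro u v huv hv h
    have hs : ∀ k, u < k → k ≤ v → Shadowed N f k := fun k h1 h2 =>
      ⟨u, by omega, by omega, h k h1 h2⟩
    refine ⟨hs v huv le_rfl, fun A h1 h2 => ?_⟩
    have h3 : ∀ i : ℕ, A + i ≤ v + 1 → g (A + i) - g A = g' (A + i) - g' A := by
      intro i
      induction i with
      | zero => simp
      | succ i ih =>
        intro hi
        push_cast at hi ⊢
        have h4 := ih (by omega)
        have h5 := hgg' (A + i) fun _ => hs _ (by omega) (by omega)
        rw [← add_assoc]
        omega
    have := h3 (v + 1 - A).toNat (by omega)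
    rw [show A + ((v + 1 - A).toNat : ℤ) = v + 1 by omega] at this
    omega
  constructor
  · intro h u v hu hv h1 h2
    obtain ⟨A, h3, h4, h5⟩ := h u v hu ((hdes v).1 hv).1 h1 h2
    rcases key u v hu h2 with ⟨B, h6, h7, h8⟩ | h6
    · exact ⟨B, h6, h7, Or.inl h8⟩
    · exact ⟨A, h3, h4, by rwa [← (key' u v h1 h2 h6).2 A h3 h4]⟩
  · intro h u v hu hv h1 h2
    rcases key u v hu h2 with ⟨B, h6, h7, h8⟩ | h6
    · exact ⟨B, h6, h7, Or.inl h8⟩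
    · obtain ⟨h7, h8⟩ := key' u v h1 h2 h6
      obtain ⟨A, h3, h4, h5⟩ := h u v hu ((hdes v).2 ⟨hv, h7⟩) h1 h2
      exact ⟨A, h3, h4, by rwa [h8 A h3 h4]⟩

/-- Two quasi-periodic walks attached to a compatible pair of sets of edges. The ascents of `f`
are the edges of the first set, its descents are the vertical edges; the descents of `g` are the
edges of the second set, its ascents are the horizontal edges. -/
structure CompatibleWalks (N : ℕ) (f g : ℤ → ℤ) : Prop where
  f_step : ∀ k, f k - 1 ≤ f (k + 1)
  g_step : ∀ k, g (k + 1) ≤ g k + 1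
  step_iff : ∀ k, f (k + 1) < f k ↔ g (k + 1) ≤ g k
  f_add : ∃ T, ∀ k, f (k + N) = f k + T
  g_add : ∃ T, ∀ k, g (k + N) = g k + T
  compat : WalkCompat N f g

/-! ### Reversal, and how the two shadows exclude each other -/

namespace CompatibleWalks

variable {N : ℕ} {f g : ℤ → ℤ}

theorem reverse (h : CompatibleWalks N f g) :
    CompatibleWalks N (fun i => g (-i)) (fun i => f (-i)) where
  f_step k := by
    have := h.g_step (-(k + 1))
    rw [show -(k + 1) + 1 = -k by ring] at this
    omega
  g_step k := by
    have := h.f_step (-(k + 1))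
    rw [show -(k + 1) + 1 = -k by ring] at this
    omega
  step_iff k := by
    have := h.step_iff (-(k + 1))
    rw [show -(k + 1) + 1 = -k by ring] at this
    omega
  f_add := by
    obtain ⟨T, hT⟩ := h.g_add
    refine ⟨-T, fun k => ?_⟩
    have := hT (-(k + N))
    rw [show -(k + N) + (N : ℤ) = -k by ring] at this
    omega
  g_add := by
    obtain ⟨T, hT⟩ := h.f_add
    refine ⟨-T, fun k => ?_⟩
    have := hT (-(k + N))
    rw [show -(k + N) + (N : ℤ) = -k by ring] at this
    omega
  compat := h.compat.reverse

/-- The edge `v` is the one that first takes `g` below its level `g (k + 1)`. -/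
theorem exists_descent (k : ℤ) (hk : ShadowedR N g k) :
    ∃ v, k < v ∧ v < k + N ∧ g (v + 1) < g v ∧ ∀ A, k < A → A ≤ v → g (v + 1) < g A := by
  obtain ⟨j, h1, h2, h3⟩ := hk
  have hex : ∃ i : ℕ, g (k + 1 + i) < g (k + 1) := ⟨(j - k - 1).toNat, by
    rwa [show k + 1 + ((j - k - 1).toNat : ℤ) = j by omega]⟩
  classical
  have hs := Nat.find_spec hex
  have hm : ∀ i : ℕ, i < Nat.find hex → g (k + 1) ≤ g (k + 1 + i) := fun i hi =>
    not_lt.1 (Nat.find_min hex hi)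
  have hle : Nat.find hex ≤ (j - k - 1).toNat := Nat.find_min' hex (by
    rwa [show k + 1 + ((j - k - 1).toNat : ℤ) = j by omega])
  set n := Nat.find hex
  have hpos : 0 < n := by
    rcases Nat.eq_zero_or_pos n with h0 | h0
    · rw [h0] at hs; simp at hs
    · exact h0
  have hall : ∀ A, k < A → A ≤ k + n → g (k + n + 1) < g A := fun A hA1 hA2 => by
    have := hm (A - k - 1).toNat (by omega)
    rw [show k + 1 + ((A - k - 1).toNat : ℤ) = A by omega] at this
    rw [show k + n + 1 = k + 1 + n by ring]
    omega
  exact ⟨k + n, by omega, by omega, hall _ (by omega) le_rfl, hall⟩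

/-- The last minimum of a function on an interval. -/
theorem exists_last_min (f : ℤ → ℤ) {k v : ℤ} (hkv : k ≤ v) :
    ∃ u, k ≤ u ∧ u ≤ v ∧ (∀ j, k ≤ j → j ≤ v → f u ≤ f j) ∧ ∀ j, u < j → j ≤ v → f u < f j := by
  obtain ⟨w, hw, hmin⟩ := exists_min_image (Icc k v) f ⟨k, by simp [hkv]⟩
  have hne : ({u ∈ Icc k v | f u ≤ f w} : Finset ℤ).Nonempty := ⟨w, by simp [hw]⟩
  obtain ⟨u, hu, hmax⟩ := exists_max_image _ id hne
  simp only [mem_filter, mem_Icc, id] at hu hmax hmin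
  refine ⟨u, hu.1.1, hu.1.2, fun j h1 h2 => hu.2.trans (hmin j ⟨h1, h2⟩), fun j h1 h2 => ?_⟩
  by_contra h3
  have := hmax j ⟨⟨by omega, h2⟩, by omega⟩
  omega

/-- Otherwise take the descent `v` of `g` given by `exists_descent` and the last minimum `u` of `f`
on `[k, v]`. Since `v` is shadowed and `k` is not, `f u < f v`, so `u` is an ascent above which `f`
stays up to `v`, and `u`, `v` violate compatibility. -/
theorem not_shadowedR_of_not_shadowed (h : CompatibleWalks N f g)
    (hsh : ∀ v, g (v + 1) < g v → Shadowed N f v) {k : ℤ} (hk : ¬ Shadowed N f k) :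
    ¬ ShadowedR N g k := by
  intro hR
  obtain ⟨v, h1, h2, h3, h4⟩ := exists_descent k hR
  obtain ⟨u, h5, h6, h7, h8⟩ := exists_last_min f h1.le
  have huv : f u < f v := by
    obtain ⟨j, h9, h10, h11⟩ := hsh v h3
    rcases le_or_gt k j with hj | hj
    · have := h7 j hj h10
      omega
    · have h12 : f k ≤ f j := not_lt.1 fun hlt => hk ⟨j, by omega, by omega, hlt⟩
      have := h7 k le_rfl h1.le
      omega
  have hne : u ≠ v := by rintro rfl; omega
  obtain ⟨A, h9, h10, h11⟩ := h.compat u v (h8 _ (by omega) (by omega)) h3 (by omega) (by omega)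
  have := h8 A h9 h10
  have := h4 A (by omega) h10
  omega

theorem not_shadowedR_of_forall_lt (h : CompatibleWalks N f g) {k : ℤ}
    (hk : ∀ j, k < j → j ≤ k + N → f k < f j) : ¬ ShadowedR N g k := by
  intro hR
  obtain ⟨v, h1, h2, h3, h4⟩ := exists_descent k hR
  obtain ⟨A, h9, h10, h11⟩ := h.compat k v (hk _ (by omega) (by omega)) h3 h1 h2
  have := hk A h9 (by omega)
  have := h4 A (by omega) h10
  omega

end CompatibleWalks

theorem sum_range_int_shift {N : ℕ} {φ : ℤ → ℤ} (hφ : ∀ k, φ (k + N) = φ k) (k : ℤ) :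
    ∑ i ∈ range N, φ (k + i) = ∑ i ∈ range N, φ i := by
  have hs : ∀ k : ℤ, ∑ i ∈ range N, φ (k + 1 + i) = ∑ i ∈ range N, φ (k + i) := fun k => by
    have h1 := Finset.sum_range_succ (fun i : ℕ => φ (k + i)) N
    have h2 := Finset.sum_range_succ' (fun i : ℕ => φ (k + i)) N
    rw [h1, hφ] at h2
    push_cast at h2
    simp only [add_zero] at h2
    rw [add_right_cancel_iff] at h2
    rw [h2]
    exact sum_congr rfl fun i _ => by congr 1; ring
  induction k using Int.induction_on with
  | zero => simp
  | succ i ih => rw [hs, ih]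
  | pred i ih => rw [← ih, ← hs]; simp

/-! ### Comparison of the weights of the two shadows -/

section Main

variable {N : ℕ} {f g L : ℤ → ℤ} {a₁ a₂ : ℤ}

open Classical in
/-- The contribution of an edge to `a₁ |sh(S₁)| - a₂ |sh(S₂)|`. -/
noncomputable def shadowWeight (N : ℕ) (f g : ℤ → ℤ) (a₁ a₂ k : ℤ) : ℤ :=
  (if f (k + 1) < f k ∧ Shadowed N f k then a₁ else 0) -
    if f k ≤ f (k + 1) ∧ ShadowedR N g k then a₂ else 0

theorem shadowWeight_add_period (h : CompatibleWalks N f g) (k : ℤ) :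
    shadowWeight N f g a₁ a₂ (k + N) = shadowWeight N f g a₁ a₂ k := by
  obtain ⟨T, hT⟩ := h.f_add
  obtain ⟨T', hT'⟩ := h.g_add
  have hT1 : ∀ k, f (k + N + 1) = f (k + 1) + T := fun k => by
    rw [show k + N + 1 = k + 1 + (N : ℤ) by ring, hT]
  unfold shadowWeight
  classical
  refine congrArg₂ (· - ·) ?_ ?_ <;> refine if_congr ?_ rfl rfl
  · rw [Shadowed.add_period hT, hT, hT1, add_lt_add_iff_right]
  · rw [ShadowedR.add_period hT', hT, hT1, add_le_add_iff_right]

/-- Every edge weighs at least the decrease of `L` along it: a shadowed vertical edge weighs `a₁`, a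
horizontal edge at least `-a₂`. The first edge is horizontal and unshadowed, so it weighs `0`
instead of `-a₂`; this is the extra `a₂`. -/
theorem le_sum_shadowWeight (ha₂ : 0 ≤ a₂)
    (hL : ∀ k, L (k + 1) = L k + if f (k + 1) < f k then -a₁ else a₂) {k : ℤ} {n : ℕ} (hn : 0 < n)
    (hk : f k ≤ f (k + 1)) (hk' : ¬ ShadowedR N g k)
    (hV : ∀ i : ℕ, i < n → f (k + i + 1) < f (k + i) → Shadowed N f (k + i)) :
    a₂ - (L (k + n) - L k) ≤ ∑ i ∈ range n, shadowWeight N f g a₁ a₂ (k + i) := by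
  induction n, hn using Nat.le_induction with
  | base =>
    have h1 := hL k
    rw [if_neg (by omega)] at h1
    have h2 : shadowWeight N f g a₁ a₂ k = 0 := by
      rw [shadowWeight, if_neg (fun h => by omega), if_neg (fun h => hk' h.2), sub_zero]
    simp [h2, h1]
  | succ n hn ih =>
    have h0 := ih fun i hi => hV i (by omega)
    rw [sum_range_succ]
    have h1 := hL (k + n)
    have h2 := hV n (by omega)
    have h3 : L (k + n) - L (k + n + 1) ≤ shadowWeight N f g a₁ a₂ (k + n) := by
      rw [h1, shadowWeight]
      by_cases h4 : f (k + n + 1) < f (k + n)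
      · rw [if_pos h4, if_pos ⟨h4, h2 h4⟩, if_neg (fun h => by omega)]
        omega
      · rw [if_neg h4, if_neg (fun h => h4 h.1)]
        split_ifs <;> omega
    push_cast
    rw [← add_assoc]
    omega

/-- The segment is cut at the running minima of `f`. Flat and descending steps from an unshadowed
point weigh nothing; an excursion above such a point has positive weight. -/
theorem sum_shadowWeight_nonneg (h : CompatibleWalks N f g) (ha₂ : 0 ≤ a₂)
    (hL : ∀ k, L (k + 1) = L k + if f (k + 1) < f k then -a₁ else a₂)
    (hL0 : ∀ k, 0 ≤ L k) (hLV : ∀ k, f (k + 1) < f k → L (k + 1) < a₂)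
    (hsh : ∀ v, g (v + 1) < g v → Shadowed N f v) (n : ℕ) (hn : n ≤ N) (k : ℤ)
    (hk : ¬ Shadowed N f k) (hkn : ∀ i : ℕ, i < n → f (k + n) ≤ f (k + i)) :
    0 ≤ ∑ i ∈ range n, shadowWeight N f g a₁ a₂ (k + i) ∧
    ((∃ i < n, f (k + i) < f (k + i + 1)) →
      0 < ∑ i ∈ range n, shadowWeight N f g a₁ a₂ (k + i)) := by
  induction n using Nat.strong_induction_on generalizing k with
  | _ n ih =>
  rcases Nat.eq_zero_or_pos n with rfl | hpos
  · simp
  have hkR := h.not_shadowedR_of_not_shadowed hsh hk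
  have hmin : ∀ j, k - N < j → j ≤ k → f k ≤ f j := fun j h1 h2 =>
    not_lt.1 fun hlt => hk ⟨j, h1, h2, hlt⟩
  rcases le_or_gt (f (k + 1)) (f k) with hstep | hstep
  · obtain ⟨n, rfl⟩ : ∃ n', n = n' + 1 := ⟨n - 1, by omega⟩
    have e : ∑ i ∈ range (n + 1), shadowWeight N f g a₁ a₂ (k + i) =
        ∑ i ∈ range n, shadowWeight N f g a₁ a₂ (k + 1 + i) := by
      have h0 : shadowWeight N f g a₁ a₂ k = 0 := by
        rw [shadowWeight, if_neg (fun h => hk h.2), if_neg (fun h => hkR h.2), sub_zero]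
      rw [sum_range_succ']
      simp only [Nat.cast_zero, add_zero, h0]
      exact sum_congr rfl fun i _ => by congr 1; push_cast; ring
    have := ih n (by omega) (by omega) (k + 1) (by
      rintro ⟨j, h1, h2, h3⟩
      rcases eq_or_ne j (k + 1) with rfl | h4
      · omega
      · have := hmin j (by omega) (by omega)
        omega) (fun i hi => by
      have := hkn (i + 1) (by omega)
      push_cast at this
      rwa [show k + (n + 1) = k + 1 + n by ring, show k + (i + 1) = k + 1 + (i : ℤ) by ring]
        at this)
    rw [e]
    refine ⟨this.1, fun ⟨i, hi, hlt⟩ => this.2 ?_⟩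
    rcases i with _ | i
    · simp at hlt; omega
    · refine ⟨i, by omega, ?_⟩
      push_cast at hlt
      rwa [show k + (i + 1) = k + 1 + (i : ℤ) by ring] at hlt
  · suffices hlt : 0 < ∑ i ∈ range n, shadowWeight N f g a₁ a₂ (k + i) from ⟨hlt.le, fun _ => hlt⟩
    classical
    -- The first return ends the excursion; it is a unit descent, so it lands exactly on the level
    -- `f k`.
    have hex : ∃ i : ℕ, 0 < i ∧ f (k + i) ≤ f k := ⟨n, hpos, by simpa using hkn 0 hpos⟩
    have hs := Nat.find_spec hex
    have hm : ∀ i : ℕ, 0 < i → i < Nat.find hex → f k < f (k + i) := fun i h0 hi =>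
      not_le.1 fun hle => Nat.find_min hex hi ⟨h0, hle⟩
    have hle : Nat.find hex ≤ n := Nat.find_min' hex ⟨hpos, by simpa using hkn 0 hpos⟩
    set d := Nat.find hex
    have hd1 : 1 < d := by
      rcases Nat.lt_or_ge 1 d with h1 | h1
      · exact h1
      · have : d = 1 := by omega
        rw [this] at hs
        push_cast at hs
        omega
    have hlast := hm (d - 1) (by omega) (by omega)
    have hfs := h.f_step (k + (d - 1 : ℕ))
    have ed : k + ((d - 1 : ℕ) : ℤ) + 1 = k + d := by omega
    rw [ed] at hfs
    have hfd : f (k + d) = f k := by omega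
    have h1 := le_sum_shadowWeight (N := N) (g := g) ha₂ hL (k := k) (n := d) (by omega)
      hstep.le hkR (fun i hi hv => by
        rcases Nat.eq_zero_or_pos i with rfl | h0
        · simp at hv; omega
        · exact ⟨k, by omega, by omega, hm i h0 hi⟩)
    -- The excursion ends with a vertical edge, so `L (k + d) < a₂`, while `L k ≥ 0`: the bound `h1`
    -- is positive.
    have h2 := hLV (k + (d - 1 : ℕ)) (by rw [ed]; omega)
    rw [ed] at h2
    have h3 := hL0 k
    have h4 := (ih (n - d) (by omega) (by omega) (k + d) (by
      rintro ⟨j, h5, h6, h7⟩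
      rcases le_or_gt j k with h8 | h8
      · have := hmin j (by omega) h8
        omega
      · rcases eq_or_ne j (k + d) with rfl | h9
        · omega
        · have := hm (j - k).toNat (by omega) (by omega)
          rw [show k + ((j - k).toNat : ℤ) = j by omega] at this
          omega) (fun i hi => by
      have := hkn (d + i) (by omega)
      rwa [show k + d + ((n - d : ℕ) : ℤ) = k + n by omega,
        show k + d + (i : ℤ) = k + (d + i : ℕ) by push_cast; ring])).1
    have h5 : ∑ i ∈ range n, shadowWeight N f g a₁ a₂ (k + i) =
        ∑ i ∈ range d, shadowWeight N f g a₁ a₂ (k + i) +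
        ∑ i ∈ range (n - d), shadowWeight N f g a₁ a₂ (k + d + i) := by
      rw [show n = d + (n - d) by omega, sum_range_add]
      congr 1
      rw [Nat.add_sub_cancel_left]
      exact sum_congr rfl fun i _ => by congr 1; push_cast; ring
    omega

/-- If all descents of `g` are in the shadow of ascents of `f`, then the shadow of the ascents of
`f` outweighs the shadow of the descents of `g`. -/
theorem sum_shadowWeight_pos (h : CompatibleWalks N f g) (hN : 0 < N) (ha₂ : 0 < a₂)
    (hL : ∀ k, L (k + 1) = L k + if f (k + 1) < f k then -a₁ else a₂)
    (hLN : ∀ k, L (k + N) = L k)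
    (hL0 : ∀ k, 0 ≤ L k) (hLV : ∀ k, f (k + 1) < f k → L (k + 1) < a₂)
    (hsh : ∀ v, g (v + 1) < g v → Shadowed N f v) (hne : ∃ u, f u < f (u + 1)) :
    0 < ∑ i ∈ range N, shadowWeight N f g a₁ a₂ i := by
  obtain ⟨T, hT⟩ := h.f_add
  have hT1 : ∀ k, f (k + N + 1) = f (k + 1) + T := fun k => by
    rw [show k + N + 1 = k + 1 + (N : ℤ) by ring, hT]
  have hper := shadowWeight_add_period (a₁ := a₁) (a₂ := a₂) h
  rcases lt_or_ge 0 T with hpos | hneg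
  -- With positive drift a single excursion fills the whole period and every vertical edge is
  -- shadowed; as `L` is periodic, the weight is at least `a₂`.
  · obtain ⟨u, h1, h2, h3, h4⟩ := CompatibleWalks.exists_last_min f (k := 0) (v := N - 1) (by omega)
    have hu : ∀ j, u < j → j ≤ u + N → f u < f j := fun j h5 h6 => by
      rcases le_or_gt j (N - 1) with h7 | h7
      · exact h4 j h5 h7
      · have h8 := h3 (j - N) (by omega) (by omega)
        have h9 := hT (j - N)
        rw [sub_add_cancel] at h9
        omega
    have h5 := le_sum_shadowWeight (N := N) (g := g) ha₂.le hL (k := u) hN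
      (hu _ (by omega) (by omega)).le (h.not_shadowedR_of_forall_lt hu) (fun i _ hv => by
        refine ⟨u + i + 1 - N, by omega, by omega, ?_⟩
        have := hT (u + i + 1 - N)
        rw [sub_add_cancel] at this
        omega)
    rw [hLN] at h5
    rw [sum_range_int_shift hper] at h5
    omega
  -- With nonpositive drift a minimum over one period is unshadowed, and the period after it ends at
  -- its lowest level.
  · obtain ⟨k, hk, hmin⟩ := exists_min_image (Ioc (0 : ℤ) N) f ⟨N, by simp; omega⟩
    simp only [mem_Ioc] at hk hmin
    obtain ⟨w, hw⟩ := hne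
    have hwN : ∀ (t : ℕ), f (w - t * N) < f (w - t * N + 1) ∧ f (w + t * N) < f (w + t * N + 1) := by
      intro t
      induction t with
      | zero => simpa using hw
      | succ t iht =>
        constructor
        · have h1 := hT (w - (t + 1) * N)
          have h2 := hT1 (w - (t + 1) * N)
          rw [show w - (t + 1) * N + (N : ℤ) = w - t * N by ring] at h1 h2
          push_cast
          omega
        · have h1 := hT (w + t * N)
          have h2 := hT1 (w + t * N)
          push_cast
          rw [show w + (t + 1) * N = w + t * N + (N : ℤ) by ring]
          omega
    -- The given ascent is translated into the period that starts at `k`.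
    have hex : ∃ i : ℕ, i < N ∧ f (k + i) < f (k + i + 1) := by
      have e1 := Int.emod_add_mul_ediv (w - k) N
      have e2 := Int.emod_nonneg (w - k) (b := (N : ℤ)) (by omega)
      have e3 := Int.emod_lt_of_pos (w - k) (b := (N : ℤ)) (by omega)
      refine ⟨((w - k) % N).toNat, by omega, ?_⟩
      rw [Int.toNat_of_nonneg e2]
      rcases le_total 0 ((w - k) / N) with h0 | h0
      · have := (hwN ((w - k) / N).toNat).1
        rw [Int.toNat_of_nonneg h0] at this
        rwa [show k + (w - k) % N = w - (w - k) / N * N by linarith]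
      · have := (hwN (-((w - k) / N)).toNat).2
        rw [Int.toNat_of_nonneg (by omega)] at this
        rwa [show k + (w - k) % N = w + -((w - k) / N) * N by linarith]
    have := (sum_shadowWeight_nonneg (a₁ := a₁) h ha₂.le hL hL0 hLV hsh N le_rfl k (by
      rintro ⟨j, h1, h2, h3⟩
      rcases lt_or_ge 0 j with h4 | h4
      · have := hmin j ⟨h4, by omega⟩
        omega
      · have := hmin (j + N) ⟨by omega, by omega⟩
        have := hT j
        omega) (fun i hi => by
      rw [hT]
      rcases le_or_gt (k + i) N with h4 | h4
      · have := hmin (k + i) ⟨by omega, h4⟩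
        omega
      · have h5 := hmin (k + i - N) ⟨by omega, by omega⟩
        have h6 := hT (k + i - N)
        rw [sub_add_cancel] at h6
        omega)).2 hex
    rwa [sum_range_int_shift hper] at this

theorem sum_range_int_neg {N : ℕ} {φ : ℤ → ℤ} (hφ : ∀ k, φ (k + N) = φ k) :
    ∑ i ∈ range N, φ (-i - 1) = ∑ i ∈ range N, φ i := by
  rw [← Finset.sum_range_reflect (fun i : ℕ => φ i)]
  refine sum_congr rfl fun i hi => ?_
  rw [mem_range] at hi
  rw [← hφ]
  congr 1
  omega

theorem shadowWeight_reverse (h : CompatibleWalks N f g) (k : ℤ) :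
    shadowWeight N (fun i => g (-i)) (fun i => f (-i)) a₂ a₁ k =
      - shadowWeight N f g a₁ a₂ (-k - 1) := by
  have h1 := h.step_iff (-k - 1)
  rw [sub_add_cancel] at h1
  unfold shadowWeight
  classical
  rw [neg_sub]
  refine congrArg₂ (· - ·) ?_ ?_ <;> refine if_congr ?_ rfl rfl
  · simp only [shadowed_comp_neg, show -(k + 1) = -k - 1 by ring, sub_add_cancel]
    refine and_congr_left fun _ => ?_
    omega
  · simp only [shadowedR_comp_neg, show -(k + 1) = -k - 1 by ring, sub_add_cancel]
    refine and_congr_left fun _ => ?_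
    omega

/-- If all ascents of `f` are in the shadow of descents of `g`, then the shadow of the descents of
`g` outweighs the shadow of the ascents of `f`. -/
theorem sum_shadowWeight_neg (h : CompatibleWalks N f g) (hN : 0 < N) (ha₁ : 0 < a₁)
    (hL : ∀ k, L (k + 1) = L k + if f (k + 1) < f k then -a₁ else a₂)
    (hLN : ∀ k, L (k + N) = L k)
    (hL0 : ∀ k, 0 ≤ L k) (hLH : ∀ k, f k ≤ f (k + 1) → L k < a₁)
    (hsh : ∀ u, f u < f (u + 1) → ShadowedR N g u) (hne : ∃ v, g (v + 1) < g v) :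
    ∑ i ∈ range N, shadowWeight N f g a₁ a₂ i < 0 := by
  have e : ∀ k : ℤ, -(k + 1) = -k - 1 := fun k => by ring
  have hs : ∀ k : ℤ, g (-k - 1) < g (-k) ↔ f (-k - 1) ≤ f (-k) := fun k => by
    have := h.step_iff (-k - 1)
    rw [sub_add_cancel] at this
    omega
  have := sum_shadowWeight_pos (L := fun k => L (-k)) (a₁ := a₂) (a₂ := a₁) h.reverse hN ha₁
    (fun k => by
      have h1 := hL (-k - 1)
      have h2 := hs k
      rw [sub_add_cancel] at h1
      simp only [e]
      rw [h1]
      split_ifs <;> omega)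
    (fun k => by
      have := hLN (-(k + N))
      rw [show -(k + N) + (N : ℤ) = -k by ring] at this
      exact this.symm)
    (fun k => hL0 _)
    (fun k hk => by
      simp only [e] at hk ⊢
      refine hLH _ ?_
      rw [sub_add_cancel]
      exact (hs k).1 hk)
    (fun v hv => by
      rw [shadowed_comp_neg]
      refine hsh _ ?_
      rw [sub_add_cancel, ← e]
      exact hv)
    (by
      obtain ⟨v, hv⟩ := hne
      refine ⟨-(v + 1), ?_⟩
      simpa using hv)
  simp only [shadowWeight_reverse h, sum_neg_distrib] at this
  rw [sum_range_int_neg (φ := shadowWeight N f g a₁ a₂) (shadowWeight_add_period h)] at this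
  omega

end Main

end GreedyRank2

namespace GreedyRank2

open Finset

/-! ### Periodic edge sets as integer walks -/

section CyclicSum

variable {N : ℕ}

/-- The edge that starts at the integer point `k` of the universal cover of the closed path. -/
def edgeAt (hN : 0 < N) (k : ℤ) : Fin N :=
  ⟨(k % N).toNat, by
    have := Int.emod_nonneg k (b := (N : ℤ)) (by omega)
    have := Int.emod_lt_of_pos k (b := (N : ℤ)) (by omega)
    omega⟩

/-- The quasi-periodic walk on `ℤ` with the given periodic steps. -/
def cyclicSum (w : Fin N → ℤ) (k : ℤ) : ℤ :=
  k / N * ∑ i, w i + ∑ i : Fin N, if (i : ℤ) < k % N then w i else 0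

theorem edgeAt_add_mul (hN : 0 < N) (k t : ℤ) : edgeAt hN (k + t * N) = edgeAt hN k := by
  simp [edgeAt]

theorem edgeAt_coe (hN : 0 < N) (i : Fin N) : edgeAt hN i = i := by
  ext
  simp only [edgeAt]
  rw [Int.emod_eq_of_lt (by omega) (by omega)]
  simp

theorem exists_eq_add_mul (hN : 0 < N) (k : ℤ) : ∃ t : ℤ, k = edgeAt hN k + t * N := by
  refine ⟨k / N, ?_⟩
  have e1 := Int.emod_add_mul_ediv k N
  have e2 := Int.emod_nonneg k (b := (N : ℤ)) (by omega)
  simp only [edgeAt]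
  rw [Int.toNat_of_nonneg e2]
  linarith

theorem cyclicSum_add_mul (hN : 0 < N) (w : Fin N → ℤ) (k t : ℤ) :
    cyclicSum w (k + t * N) = cyclicSum w k + t * ∑ i, w i := by
  simp only [cyclicSum, Int.add_mul_emod_self_right]
  rw [Int.add_mul_ediv_right _ _ (by omega)]
  ring

theorem cyclicSum_add_period (hN : 0 < N) (w : Fin N → ℤ) (k : ℤ) :
    cyclicSum w (k + N) = cyclicSum w k + ∑ i, w i := by
  simpa using cyclicSum_add_mul hN w k 1

theorem cyclicSum_coe (w : Fin N → ℤ) (A : Fin N) :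
    cyclicSum w A = ∑ i : Fin N, if i < A then w i else 0 := by
  have h1 : (A : ℤ) / N = 0 := Int.ediv_eq_zero_of_lt (by omega) (by omega)
  have h2 : (A : ℤ) % N = A := Int.emod_eq_of_lt (by omega) (by omega)
  rw [cyclicSum, h1, h2, zero_mul, zero_add]
  exact sum_congr rfl fun i _ => by congr 1; simp

theorem cyclicSum_succ (hN : 0 < N) (w : Fin N → ℤ) (k : ℤ) :
    cyclicSum w (k + 1) = cyclicSum w k + w (edgeAt hN k) := by
  obtain ⟨t, ht⟩ := exists_eq_add_mul hN k
  generalize edgeAt hN k = i at ht ⊢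
  subst ht
  rw [show (i : ℤ) + t * N + 1 = (i : ℤ) + 1 + t * N by ring, cyclicSum_add_mul hN,
    cyclicSum_add_mul hN]
  suffices cyclicSum w ((i : ℤ) + 1) = cyclicSum w i + w i by rw [this]; ring
  rcases Nat.lt_or_ge ((i : ℕ) + 1) N with h | h
  · have := cyclicSum_coe w ⟨i + 1, h⟩
    push_cast at this
    have e : w i = ∑ j, if j = i then w j else 0 := by simp
    rw [this, cyclicSum_coe, e, ← sum_add_distrib]
    refine sum_congr rfl fun j _ => ?_
    simp only [Fin.lt_def, Fin.ext_iff]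
    split_ifs <;> omega
  · have h1 : (i : ℤ) + 1 = 0 + N := by omega
    rw [h1, cyclicSum_add_period hN]
    have h0 := cyclicSum_coe w ⟨0, hN⟩
    simp only [Fin.lt_def, Nat.not_lt_zero, if_false, sum_const_zero, Nat.cast_zero] at h0
    have e : w i = ∑ j, if j = i then w j else 0 := by simp
    rw [h0, zero_add, cyclicSum_coe, e, ← sum_add_distrib]
    refine sum_congr rfl fun j _ => ?_
    simp only [Fin.lt_def, Fin.ext_iff]
    split_ifs <;> omega

/-- The lift to the universal cover of a point `B`, seen as the end of a path that starts
at `A`. -/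
def liftAfter (A B : Fin N) : ℤ := if A < B then B else B + N

/-- The lift of `B` lies in `(A, A + N]`, so `A = B` gives the whole closed path, as the convention
for `AA` requires. -/
theorem sum_subpath (w : Fin N → ℤ) (A B : Fin N) :
    ∑ k ∈ subpath A B, w k = cyclicSum w (liftAfter A B) - cyclicSum w A := by
  have hN : 0 < N := Nat.zero_lt_of_lt A.isLt
  rw [subpath, sum_filter, liftAfter]
  split_ifs with h
  · rw [cyclicSum_coe, cyclicSum_coe, ← sum_sub_distrib]
    refine sum_congr rfl fun j _ => ?_
    simp only [Fin.lt_def, Fin.le_def] at *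
    split_ifs <;> omega
  · rw [cyclicSum_add_period hN, cyclicSum_coe, cyclicSum_coe, ← sum_add_distrib,
      ← sum_sub_distrib]
    refine sum_congr rfl fun j _ => ?_
    simp only [Fin.lt_def, Fin.le_def] at *
    split_ifs <;> omega

/-! ### The walks of a pair of edge sets, and compatibility on the universal cover -/

variable {V S₁ S₂ : Finset (Fin N)}

/-- The walk that goes down by `1` at the vertical edges and up by `c` at the edges in `S₁`. -/
def walk₁ (c : ℕ) (V S₁ : Finset (Fin N)) : ℤ → ℤ :=
  cyclicSum fun i => (if i ∈ S₁ then (c : ℤ) else 0) - if i ∈ V then 1 else 0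

/-- The walk that goes up by `1` at the horizontal edges and down by `b` at the edges in `S₂`. -/
def walk₂ (b : ℕ) (V S₂ : Finset (Fin N)) : ℤ → ℤ :=
  cyclicSum fun i => (if i ∈ V then 0 else 1) - if i ∈ S₂ then (b : ℤ) else 0

theorem walk₁_succ (hN : 0 < N) (c : ℕ) (V S₁ : Finset (Fin N)) (k : ℤ) :
    walk₁ c V S₁ (k + 1) = walk₁ c V S₁ k +
      ((if edgeAt hN k ∈ S₁ then (c : ℤ) else 0) - if edgeAt hN k ∈ V then 1 else 0) :=
  cyclicSum_succ hN _ k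

theorem walk₂_succ (hN : 0 < N) (b : ℕ) (V S₂ : Finset (Fin N)) (k : ℤ) :
    walk₂ b V S₂ (k + 1) = walk₂ b V S₂ k +
      ((if edgeAt hN k ∈ V then 0 else 1) - if edgeAt hN k ∈ S₂ then (b : ℤ) else 0) :=
  cyclicSum_succ hN _ k

theorem walk₁_add_period (hN : 0 < N) (c : ℕ) (V S₁ : Finset (Fin N)) (k : ℤ) :
    walk₁ c V S₁ (k + N) = walk₁ c V S₁ k + (c * S₁.card - V.card) := by
  rw [walk₁, cyclicSum_add_period hN]
  simp [sum_sub_distrib, mul_comm]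

theorem walk₂_add_period (hN : 0 < N) (b : ℕ) (V S₂ : Finset (Fin N)) (k : ℤ) :
    walk₂ b V S₂ (k + N) = walk₂ b V S₂ k + (Vᶜ.card - b * S₂.card) := by
  rw [walk₂, cyclicSum_add_period hN]
  have : ∀ i : Fin N, (if i ∈ V then (0 : ℤ) else 1) = if i ∈ Vᶜ then 1 else 0 := fun i => by
    by_cases h : i ∈ V <;> simp [h]
  simp_rw [this]
  rw [sum_sub_distrib, sum_boole, filter_mem_eq_inter, univ_inter]
  simp [mul_comm]

variable {b c : ℕ}

theorem card_eq_iff_walk₁ (h₁ : S₁ ⊆ Vᶜ) (u A : Fin N) :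
    (subpath u A ∩ V).card = c * (subpath u A ∩ Vᶜ ∩ S₁).card ↔
      walk₁ c V S₁ (liftAfter u A) = walk₁ c V S₁ u := by
  have h : _ = walk₁ c V S₁ _ - walk₁ c V S₁ u := sum_subpath _ u A
  rw [inter_assoc, inter_eq_right.2 h₁]
  have e1 : ∑ k ∈ subpath u A, (if k ∈ S₁ then (c : ℤ) else 0) = c * (subpath u A ∩ S₁).card := by
    simp [mul_comm]
  have e2 : ∑ k ∈ subpath u A, (if k ∈ V then (1 : ℤ) else 0) = (subpath u A ∩ V).card := by
    simp
  rw [sum_sub_distrib, e1, e2] at h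
  zify
  constructor <;> intro h' <;> linarith

theorem card_eq_iff_walk₂ (h₂ : S₂ ⊆ V) (A F : Fin N) :
    (subpath A F ∩ Vᶜ).card = b * (subpath A F ∩ V ∩ S₂).card ↔
      walk₂ b V S₂ A = walk₂ b V S₂ (liftAfter A F) := by
  have h : _ = walk₂ b V S₂ _ - walk₂ b V S₂ A := sum_subpath _ A F
  rw [inter_assoc, inter_eq_right.2 h₂]
  have e1 : ∑ k ∈ subpath A F, (if k ∈ S₂ then (b : ℤ) else 0) = b * (subpath A F ∩ S₂).card := by
    simp [mul_comm]
  have e2 : ∑ k ∈ subpath A F, (if k ∈ V then (0 : ℤ) else 1) = (subpath A F ∩ Vᶜ).card := by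
    rw [← filter_mem_eq_inter, card_filter]
    push_cast
    exact sum_congr rfl fun i _ => by by_cases h : i ∈ V <;> simp [h]
  rw [sum_sub_distrib, e1, e2] at h
  zify
  constructor <;> intro h' <;> linarith

variable (hN : 0 < N)
include hN

theorem walk₁_lt_succ_iff (hc : 0 < c) (h₁ : S₁ ⊆ Vᶜ) (k : ℤ) :
    walk₁ c V S₁ k < walk₁ c V S₁ (k + 1) ↔ edgeAt hN k ∈ S₁ := by
  rw [walk₁_succ hN]
  by_cases h : edgeAt hN k ∈ S₁
  · have := mem_compl.1 (h₁ h)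
    simp [h, this, hc]
  · simp only [h, if_false, iff_false]
    split_ifs <;> omega

theorem walk₁_succ_lt_iff (h₁ : S₁ ⊆ Vᶜ) (k : ℤ) :
    walk₁ c V S₁ (k + 1) < walk₁ c V S₁ k ↔ edgeAt hN k ∈ V := by
  rw [walk₁_succ hN]
  by_cases h : edgeAt hN k ∈ V
  · have : edgeAt hN k ∉ S₁ := fun h' => mem_compl.1 (h₁ h') h
    simp [h, this]
  · simp only [h, if_false, iff_false]
    split_ifs <;> omega

theorem walk₂_succ_lt_iff (hb : 0 < b) (h₂ : S₂ ⊆ V) (k : ℤ) :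
    walk₂ b V S₂ (k + 1) < walk₂ b V S₂ k ↔ edgeAt hN k ∈ S₂ := by
  rw [walk₂_succ hN]
  by_cases h : edgeAt hN k ∈ S₂
  · have := h₂ h
    simp [h, this, hb]
  · simp only [h, if_false, iff_false]
    split_ifs <;> omega

theorem walk₂_succ_le_iff (h₂ : S₂ ⊆ V) (k : ℤ) :
    walk₂ b V S₂ (k + 1) ≤ walk₂ b V S₂ k ↔ edgeAt hN k ∈ V := by
  rw [walk₂_succ hN]
  by_cases h : edgeAt hN k ∈ V
  · simp only [h, if_true, iff_true]
    split_ifs <;> omega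
  · have : edgeAt hN k ∉ S₂ := fun h' => h (h₂ h')
    simp [h, this]

/-- Inner points lift to the integers strictly between `u` and the lift of the end of `v`. That lift
is `liftAfter u v + 1`, even when the end of `v` wraps to `0` or coincides with `u`; for `u = v` it
would be off by a period. -/
theorem exists_innerPoints_iff {f g : ℤ → ℤ} {Tg : ℤ}
    (hg : ∀ k, g (k + N) = g k + Tg) {u v : Fin N} (huv : u ≠ v) :
    (∃ A ∈ innerPoints u (endpoint v), g A = g (liftAfter A (endpoint v)) ∨
      f (liftAfter u A) = f u) ↔
    ∃ A : ℤ, u < A ∧ A ≤ liftAfter u v ∧ (f A = f u ∨ g A = g (liftAfter u v + 1)) := by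
  have huv' : (u : ℕ) ≠ v := fun h => huv (Fin.ext h)
  have hend : ((endpoint v : Fin N) : ℕ) = if (v : ℕ) + 1 < N then (v : ℕ) + 1 else 0 := by
    simp only [endpoint]
    split_ifs with h
    · exact Nat.mod_eq_of_lt h
    · rw [show (v : ℕ) + 1 = N by omega, Nat.mod_self]
  have hlift : (liftAfter u v : ℤ) + 1 = liftAfter u (endpoint v) := by
    simp only [liftAfter, Fin.lt_def]
    split_ifs at hend <;> rw [hend] <;> split_ifs <;> push_cast <;> omega
  rw [hlift]
  have hle : ∀ A : ℤ, A ≤ liftAfter u v ↔ A < liftAfter u (endpoint v) := fun A => by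
    rw [← hlift]; omega
  simp only [hle]
  generalize endpoint v = F
  have hmem : ∀ A : Fin N, A ∈ innerPoints u F ↔ ((if u < F then u < A ∧ A < F
      else u < A ∨ A < F) : Prop) := fun A => by simp [innerPoints]
  have key : ∀ A : Fin N, A ∈ innerPoints u F → (u : ℤ) < liftAfter u A ∧
      (liftAfter u A : ℤ) < liftAfter u F ∧
      (g A = g (liftAfter A F) ↔ g (liftAfter u A) = g (liftAfter u F)) := by
    intro A hA
    rw [hmem] at hA
    simp only [liftAfter, Fin.lt_def] at hA ⊢
    refine ⟨by split_ifs <;> omega, by split_ifs at * <;> omega, ?_⟩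
    split_ifs at * <;> simp only [hg] <;> omega
  constructor
  · rintro ⟨A, hA, h⟩
    obtain ⟨h1, h2, h3⟩ := key A hA
    exact ⟨_, h1, h2, by rw [h3] at h; exact h.symm⟩
  · rintro ⟨A, h1, h2, h⟩
    have hB : ∃ B : Fin N, B ∈ innerPoints u F ∧ A = liftAfter u B := by
      rcases lt_or_ge A N with hA | hA
      · refine ⟨⟨A.toNat, by omega⟩, ?_, ?_⟩
        · rw [hmem]
          simp only [liftAfter, Fin.lt_def] at *
          split_ifs at * <;> omega
        · simp only [liftAfter, Fin.lt_def]
          rw [if_pos (by omega)]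
          omega
      · have h3 : (F : ℤ) ≤ u := by
          by_contra h3
          rw [liftAfter, if_pos (by rw [Fin.lt_def]; omega)] at h2
          omega
        have h2' := h2
        rw [liftAfter, if_neg (by rw [Fin.lt_def]; omega)] at h2'
        refine ⟨⟨(A - N).toNat, by omega⟩, ?_, ?_⟩
        · rw [hmem]
          simp only [Fin.lt_def]
          rw [if_neg (by omega)]
          omega
        · simp only [liftAfter, Fin.lt_def]
          rw [if_neg (by omega)]
          omega
    obtain ⟨B, hB, rfl⟩ := hB
    exact ⟨B, hB, by rw [(key B hB).2.2]; exact h.symm⟩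

theorem walk₁_step (c : ℕ) (V S₁ : Finset (Fin N)) (k : ℤ) :
    walk₁ c V S₁ k - 1 ≤ walk₁ c V S₁ (k + 1) := by
  rw [walk₁_succ hN]
  split_ifs <;> omega

theorem walk₂_step (b : ℕ) (V S₂ : Finset (Fin N)) (k : ℤ) :
    walk₂ b V S₂ (k + 1) ≤ walk₂ b V S₂ k + 1 := by
  rw [walk₂_succ hN]
  split_ifs <;> omega

theorem compatibleWalks_iff (h₁ : S₁ ⊆ Vᶜ) (h₂ : S₂ ⊆ V) :
    CompatibleWalks N (walk₁ c V S₁) (walk₂ b V S₂) ↔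
      WalkCompat N (walk₁ c V S₁) (walk₂ b V S₂) :=
  ⟨fun h => h.compat, fun h => ⟨walk₁_step hN c V S₁, walk₂_step hN b V S₂, fun k => by
    rw [walk₁_succ_lt_iff hN h₁, walk₂_succ_le_iff hN h₂],
    ⟨_, walk₁_add_period hN c V S₁⟩, ⟨_, walk₂_add_period hN b V S₂⟩, h⟩⟩

/-- Compatibility in terms of the walks on the universal cover. -/
theorem compatible_iff_walks (hb : 0 < b) (hc : 0 < c) (h₁ : S₁ ⊆ Vᶜ) (h₂ : S₂ ⊆ V) :
    (∀ u ∈ S₁, ∀ v ∈ S₂, ∃ A ∈ innerPoints u (endpoint v),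
      (subpath A (endpoint v) ∩ Vᶜ).card = b * (subpath A (endpoint v) ∩ V ∩ S₂).card ∨
      (subpath u A ∩ V).card = c * (subpath u A ∩ Vᶜ ∩ S₁).card) ↔
    CompatibleWalks N (walk₁ c V S₁) (walk₂ b V S₂) := by
  simp only [card_eq_iff_walk₁ h₁, card_eq_iff_walk₂ h₂]
  have hg := walk₂_add_period hN b V S₂
  have hne : ∀ u ∈ S₁, ∀ v ∈ S₂, u ≠ v := fun u hu v hv h =>
    mem_compl.1 (h₁ hu) (h ▸ h₂ hv)
  rw [compatibleWalks_iff hN h₁ h₂]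
  constructor
  · intro h u v hu hv huv hvu
    rw [walk₁_lt_succ_iff hN hc h₁] at hu
    rw [walk₂_succ_lt_iff hN hb h₂] at hv
    obtain ⟨A, hA1, hA2, hA3⟩ :=
      (exists_innerPoints_iff hN hg (hne _ hu _ hv)).1 (h _ hu _ hv)
    obtain ⟨t, ht⟩ := exists_eq_add_mul hN u
    obtain ⟨s, hs⟩ := exists_eq_add_mul hN v
    -- Since `v` follows `u` within a period, its period index is that of `u` or the next one. The
    -- witness for the representatives is then translated by `t` periods.
    have hl : v = liftAfter (edgeAt hN u) (edgeAt hN v) + t * N := by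
      generalize edgeAt hN u = u0 at *
      generalize edgeAt hN v = v0 at *
      have hu0 := u0.isLt
      have hv0 := v0.isLt
      have hst : s = t ∨ s = t + 1 := by
        have h1 : t * (N : ℤ) < (s + 1) * N := by linarith
        have h2 : s * (N : ℤ) < (t + 2) * N := by linarith
        have := lt_of_mul_lt_mul_right h1 (by omega)
        have := lt_of_mul_lt_mul_right h2 (by omega)
        omega
      simp only [liftAfter, Fin.lt_def]
      rcases hst with rfl | rfl
      · rw [if_pos (by omega)]; exact hs
      · rw [add_mul] at hs
        rw [if_neg (by omega)]; omega
    have e1 : ∀ k t, walk₁ c V S₁ (k + t * N) = walk₁ c V S₁ k + t * _ :=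
      cyclicSum_add_mul hN _
    have e2 : ∀ k t, walk₂ b V S₂ (k + t * N) = walk₂ b V S₂ k + t * _ :=
      cyclicSum_add_mul hN _
    refine ⟨A + t * N, by omega, by omega, ?_⟩
    rcases hA3 with h3 | h3
    · left
      conv_rhs => rw [ht]
      rw [e1, e1, h3]
    · right
      conv_rhs => rw [hl]
      rw [add_right_comm, e2, e2, h3]
  · intro h u hu v hv
    refine (exists_innerPoints_iff hN hg (hne _ hu _ hv)).2 (h _ _ ?_ ?_ ?_ ?_)
    · rwa [walk₁_lt_succ_iff hN hc h₁, edgeAt_coe]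
    · rw [walk₂_succ_lt_iff hN hb h₂]
      have : edgeAt hN (liftAfter u v) = v := by
        rw [liftAfter]
        split_ifs
        · exact edgeAt_coe hN v
        · have := edgeAt_add_mul hN v 1
          rw [one_mul] at this
          rw [this, edgeAt_coe]
      rwa [this]
    · simp only [liftAfter, Fin.lt_def]
      split_ifs <;> omega
    · have : (u : ℕ) ≠ v := fun h' => hne u hu v hv (Fin.ext h')
      simp only [liftAfter, Fin.lt_def]
      split_ifs <;> omega

end CyclicSum

end GreedyRank2

namespace GreedyRank2

open Finset

/-! ### Shadows of sets of edges -/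

section Shadows

variable {N : ℕ} {b c : ℕ} {V S₁ S₂ : Finset (Fin N)}

open Classical in
/-- The shadow of a set `S₁` of horizontal edges: a set of vertical edges. -/
noncomputable def shadow₁ (c : ℕ) (V S₁ : Finset (Fin N)) : Finset (Fin N) :=
  {k ∈ V | Shadowed N (walk₁ c V S₁) k}

open Classical in
/-- The shadow of a set `S₂` of vertical edges: a set of horizontal edges. -/
noncomputable def shadow₂ (b : ℕ) (V S₂ : Finset (Fin N)) : Finset (Fin N) :=
  {k ∈ Vᶜ | ShadowedR N (walk₂ b V S₂) k}

theorem shadow₁_subset : shadow₁ c V S₁ ⊆ V := by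
  classical exact filter_subset _ _

theorem shadow₂_subset : shadow₂ b V S₂ ⊆ Vᶜ := by
  classical exact filter_subset _ _

theorem iff_edgeAt_of_periodic (hN : 0 < N) {P : ℤ → Prop} (hP : ∀ k, P (k + N) ↔ P k) (k : ℤ) :
    P (edgeAt hN k) ↔ P k := by
  have h : ∀ (t : ℕ) (k : ℤ), P (k + t * N) ↔ P k := by
    intro t
    induction t with
    | zero => simp
    | succ t ih =>
      intro k
      rw [← ih k, ← hP (k + t * N)]
      push_cast
      rw [show k + (t + 1) * (N : ℤ) = k + t * N + N by ring]
  obtain ⟨t, ht⟩ := exists_eq_add_mul hN k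
  rcases le_total 0 t with h0 | h0
  · obtain ⟨t, rfl⟩ := Int.eq_ofNat_of_zero_le h0
    conv_rhs => rw [ht]
    exact (h t _).symm
  · obtain ⟨s, hs⟩ := Int.eq_ofNat_of_zero_le (a := -t) (by omega)
    have := h s k
    rw [show k + s * (N : ℤ) = edgeAt hN k by
      rw [← hs]; conv_lhs => rw [ht]
      ring] at this
    exact this

theorem edgeAt_mem_shadow₁ (hN : 0 < N) (k : ℤ) :
    edgeAt hN k ∈ shadow₁ c V S₁ ↔ edgeAt hN k ∈ V ∧ Shadowed N (walk₁ c V S₁) k := by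
  classical
  rw [shadow₁, mem_filter,
    iff_edgeAt_of_periodic hN (Shadowed.add_period (walk₁_add_period hN c V S₁))]

theorem edgeAt_mem_shadow₂ (hN : 0 < N) (k : ℤ) :
    edgeAt hN k ∈ shadow₂ b V S₂ ↔ edgeAt hN k ∉ V ∧ ShadowedR N (walk₂ b V S₂) k := by
  classical
  rw [shadow₂, mem_filter, mem_compl,
    iff_edgeAt_of_periodic hN (ShadowedR.add_period (walk₂_add_period hN b V S₂))]

theorem sum_range_boole_edgeAt (hN : 0 < N) (S : Finset (Fin N)) (a : ℤ) :
    ∑ i ∈ range N, (if edgeAt hN i ∈ S then a else 0) = a * S.card := by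
  rw [← Fin.sum_univ_eq_sum_range (fun i : ℕ => if edgeAt hN i ∈ S then a else 0)]
  simp [edgeAt_coe, mul_comm]

theorem walk₁_empty_antitone (c : ℕ) (V : Finset (Fin N)) (hN : 0 < N) :
    Antitone (walk₁ c V ∅) := antitone_int_of_succ_le fun k => by
  rw [walk₁_succ hN]
  simp only [notMem_empty, if_false]
  split_ifs <;> omega

theorem shadow₁_empty (c : ℕ) (V : Finset (Fin N)) : shadow₁ c V ∅ = ∅ := by
  classical
  refine filter_eq_empty_iff.2 fun k _ => ?_
  rintro ⟨j, -, h1, h2⟩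
  exact absurd (walk₁_empty_antitone c V (Nat.zero_lt_of_lt k.isLt) h1) (not_le.2 h2)

theorem shadow₂_empty (b : ℕ) (V : Finset (Fin N)) : shadow₂ b V ∅ = ∅ := by
  classical
  refine filter_eq_empty_iff.2 fun k _ => ?_
  have hm : Monotone (walk₂ b V ∅) := monotone_int_of_le_succ fun k' => by
    rw [walk₂_succ (Nat.zero_lt_of_lt k.isLt)]
    simp only [notMem_empty, if_false]
    split_ifs <;> omega
  rintro ⟨j, h1, -, h2⟩
  exact absurd (hm (show (k : ℤ) + 1 ≤ j by omega)) (not_le.2 h2)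

/-- The subtraction is truncated, hence a positive part. In particular the size of the shadow
depends on `S₁` only through its cardinality. -/
theorem card_sdiff_shadow₁ (h₁ : S₁ ⊆ Vᶜ) :
    (V \ shadow₁ c V S₁).card = V.card - c * S₁.card := by
  rcases Nat.eq_zero_or_pos N with rfl | hN
  · simp [eq_empty_of_isEmpty V]
  classical
  have h := sum_unshadowed hN (walk₁_add_period hN c V S₁) (walk₁_step hN c V S₁)
  have e : ∀ k : ℤ, (if walk₁ c V S₁ (k + 1) < walk₁ c V S₁ k ∧ ¬ Shadowed N (walk₁ c V S₁) k
      then (1 : ℤ) else 0) = if edgeAt hN k ∈ V \ shadow₁ c V S₁ then 1 else 0 := fun k => by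
    refine if_congr ?_ rfl rfl
    rw [mem_sdiff, edgeAt_mem_shadow₁, walk₁_succ_lt_iff hN h₁]
    tauto
  have h' := sum_range_boole_edgeAt hN (V \ shadow₁ c V S₁) 1
  simp only [← e] at h'
  zify
  have : (c : ℤ) * S₁.card = (c * S₁.card : ℕ) := by push_cast; ring
  rw [this] at h
  have h'' := h'.symm.trans (Eq.trans (by congr!) h)
  omega

theorem card_sdiff_shadow₂ (h₂ : S₂ ⊆ V) :
    (Vᶜ \ shadow₂ b V S₂).card = Vᶜ.card - b * S₂.card := by
  rcases Nat.eq_zero_or_pos N with rfl | hN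
  · simp [eq_empty_of_isEmpty Vᶜ]
  classical
  have hT := walk₂_add_period hN b V S₂
  have h := sum_unshadowed (f := fun i => walk₂ b V S₂ (-i))
    (T := -(Vᶜ.card - b * S₂.card)) hN (fun k => by
      have := hT (-(k + N))
      rw [show -(k + N) + (N : ℤ) = -k by ring] at this
      omega) (fun k => by
      have := walk₂_step hN b V S₂ (-(k + 1))
      rw [show -(k + 1) + 1 = -k by ring] at this
      omega)
  have e : ∀ k : ℤ, (if walk₂ b V S₂ (-(k + 1)) < walk₂ b V S₂ (-k) ∧
      ¬ Shadowed N (fun i => walk₂ b V S₂ (-i)) k then (1 : ℤ) else 0) =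
        (fun k => if edgeAt hN k ∈ Vᶜ \ shadow₂ b V S₂ then 1 else 0) (-k - 1) := fun k => by
    refine if_congr ?_ rfl rfl
    have := walk₂_succ_le_iff hN (b := b) h₂ (-k - 1)
    rw [sub_add_cancel] at this
    rw [mem_sdiff, edgeAt_mem_shadow₂, mem_compl, ← this, shadowed_comp_neg,
      show -(k + 1) = -k - 1 by ring, ← not_le]
    tauto
  have h' := sum_range_boole_edgeAt hN (Vᶜ \ shadow₂ b V S₂) 1
  rw [← sum_range_int_neg (φ := fun k => if edgeAt hN k ∈ Vᶜ \ shadow₂ b V S₂ then (1 : ℤ) else 0)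
    (fun k => by have := edgeAt_add_mul hN k 1; rw [one_mul] at this; simp only [this])] at h'
  simp only [← e] at h'
  zify
  have : (b : ℤ) * S₂.card = (b * S₂.card : ℕ) := by push_cast; ring
  rw [this] at h
  have h'' := h'.symm.trans (Eq.trans (by congr!) h)
  omega

/-! ### From walks back to sets of edges -/

variable (hN : 0 < N)
include hN

theorem walkCompat_inter_shadow₁ (hb : 0 < b) (h₁ : S₁ ⊆ Vᶜ) (h₂ : S₂ ⊆ V) :
    WalkCompat N (walk₁ c V S₁) (walk₂ b V S₂) ↔
      WalkCompat N (walk₁ c V S₁) (walk₂ b V (S₂ ∩ shadow₁ c V S₁)) := by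
  refine walkCompat_congr (walk₁_step hN c V S₁) (fun k hk => ?_) fun k => ?_
  · rw [walk₂_succ hN, walk₂_succ hN, walk₁_succ_lt_iff hN h₁] at *
    have : edgeAt hN k ∈ S₂ ↔ edgeAt hN k ∈ S₂ ∩ shadow₁ c V S₁ := by
      rw [mem_inter, edgeAt_mem_shadow₁]
      exact ⟨fun h => ⟨h, h₂ h, hk (h₂ h)⟩, fun h => h.1⟩
    simp only [this]
    ring
  · rw [walk₂_succ_lt_iff hN hb h₂,
      walk₂_succ_lt_iff hN hb (inter_subset_left.trans h₂), mem_inter, edgeAt_mem_shadow₁]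
    exact ⟨fun h => ⟨h.1, h.2.2⟩, fun h => ⟨h.1, h₂ h.1, h.2⟩⟩

theorem walkCompat_inter_shadow₂ (hc : 0 < c) (h₁ : S₁ ⊆ Vᶜ) (h₂ : S₂ ⊆ V) :
    WalkCompat N (walk₁ c V S₁) (walk₂ b V S₂) ↔
      WalkCompat N (walk₁ c V (S₁ ∩ shadow₂ b V S₂)) (walk₂ b V S₂) := by
  rw [← walkCompat_reverse_iff, ← walkCompat_reverse_iff (f := walk₁ c V (S₁ ∩ shadow₂ b V S₂))]
  have e : ∀ k : ℤ, -(k + 1) = -k - 1 := fun k => by ring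
  refine walkCompat_congr (fun k => ?_) (fun k hk => ?_) fun k => ?_
  · have := walk₂_step hN b V S₂ (-k - 1)
    rw [sub_add_cancel] at this
    rw [e]
    omega
  · have h3 := walk₂_succ_le_iff hN (b := b) h₂ (-k - 1)
    have h4 := walk₁_succ hN c V S₁ (-k - 1)
    have h5 := walk₁_succ hN c V (S₁ ∩ shadow₂ b V S₂) (-k - 1)
    rw [sub_add_cancel] at h3 h4 h5
    rw [e, ← not_le, h3, shadowed_comp_neg] at hk
    rw [e, h4, h5]
    have : edgeAt hN (-k - 1) ∈ S₁ ↔ edgeAt hN (-k - 1) ∈ S₁ ∩ shadow₂ b V S₂ := by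
      rw [mem_inter, edgeAt_mem_shadow₂]
      exact ⟨fun h => ⟨h, mem_compl.1 (h₁ h), hk (mem_compl.1 (h₁ h))⟩, fun h => h.1⟩
    simp only [this]
    ring
  · have h3 := walk₁_lt_succ_iff hN hc h₁ (-k - 1)
    have h4 := walk₁_lt_succ_iff hN hc ((inter_subset_left (s₂ := shadow₂ b V S₂)).trans h₁)
      (-k - 1)
    rw [sub_add_cancel] at h3 h4
    rw [e, h3, h4, mem_inter, edgeAt_mem_shadow₂, shadowed_comp_neg]
    exact ⟨fun h => ⟨h.1, h.2.2⟩, fun h => ⟨h.1, mem_compl.1 (h₁ h.1), h.2⟩⟩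

theorem sum_shadowWeight (h₁ : S₁ ⊆ Vᶜ) (m n : ℤ) :
    ∑ i ∈ range N, shadowWeight N (walk₁ c V S₁) (walk₂ b V S₂) m n i =
      m * (shadow₁ c V S₁).card - n * (shadow₂ b V S₂).card := by
  rw [← sum_range_boole_edgeAt hN, ← sum_range_boole_edgeAt hN, ← sum_sub_distrib]
  refine sum_congr rfl fun i _ => ?_
  rw [shadowWeight]
  refine congrArg₂ (· - ·) ?_ ?_
  · classical
    refine if_congr ?_ rfl rfl
    rw [walk₁_succ_lt_iff hN h₁, edgeAt_mem_shadow₁]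
  · classical
    refine if_congr ?_ rfl rfl
    rw [← not_lt, walk₁_succ_lt_iff hN h₁, edgeAt_mem_shadow₂]

variable {L : ℤ → ℤ} {m n : ℕ}
  (hL : ∀ k, L (k + 1) = L k + if edgeAt hN k ∈ V then -(m : ℤ) else n)
  (hLN : ∀ k, L (k + N) = L k) (hL0 : ∀ k, 0 ≤ L k)
include hL hLN hL0

/-- `L` stands for the height relative to the diagonal; `hLV` is where maximality of the path will
enter. -/
theorem card_shadow₂_lt (hb : 0 < b) (hc : 0 < c) (hn : 0 < n) (h₁ : S₁ ⊆ Vᶜ) (h₂ : S₂ ⊆ V)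
    (hLV : ∀ k, edgeAt hN k ∈ V → L (k + 1) < n)
    (hcompat : WalkCompat N (walk₁ c V S₁) (walk₂ b V S₂)) (hS : S₂ ⊆ shadow₁ c V S₁)
    (hne : S₁.Nonempty) : n * (shadow₂ b V S₂).card < m * (shadow₁ c V S₁).card := by
  have := sum_shadowWeight_pos (L := L) (a₁ := m) (a₂ := n)
    ((compatibleWalks_iff hN h₁ h₂).2 hcompat) hN (by exact_mod_cast hn)
    (fun k => by rw [hL]; simp only [walk₁_succ_lt_iff hN h₁]) hLN hL0
    (fun k hk => hLV k ((walk₁_succ_lt_iff hN h₁ k).1 hk))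
    (fun v hv => ((edgeAt_mem_shadow₁ hN v).1 (hS ((walk₂_succ_lt_iff hN hb h₂ v).1 hv))).2)
    (by
      obtain ⟨u, hu⟩ := hne
      exact ⟨u, (walk₁_lt_succ_iff hN hc h₁ u).2 (by rwa [edgeAt_coe])⟩)
  rw [sum_shadowWeight hN h₁] at this
  zify
  omega

theorem card_shadow₁_lt (hb : 0 < b) (hc : 0 < c) (hm : 0 < m) (h₁ : S₁ ⊆ Vᶜ) (h₂ : S₂ ⊆ V)
    (hLH : ∀ k, edgeAt hN k ∉ V → L k < m)
    (hcompat : WalkCompat N (walk₁ c V S₁) (walk₂ b V S₂)) (hS : S₁ ⊆ shadow₂ b V S₂)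
    (hne : S₂.Nonempty) : m * (shadow₁ c V S₁).card < n * (shadow₂ b V S₂).card := by
  have := sum_shadowWeight_neg (L := L) (a₁ := m) (a₂ := n)
    ((compatibleWalks_iff hN h₁ h₂).2 hcompat) hN (by exact_mod_cast hm)
    (fun k => by rw [hL]; simp only [walk₁_succ_lt_iff hN h₁]) hLN hL0
    (fun k hk => hLH k (by rwa [← walk₁_succ_lt_iff hN h₁ (c := c), not_lt]))
    (fun v hv => ((edgeAt_mem_shadow₂ hN v).1 (hS ((walk₁_lt_succ_iff hN hc h₁ v).1 hv))).2)
    (by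
      obtain ⟨u, hu⟩ := hne
      exact ⟨u, (walk₂_succ_lt_iff hN hb h₂ u).2 (by rwa [edgeAt_coe])⟩)
  rw [sum_shadowWeight hN h₁] at this
  zify
  omega

end Shadows

/-! ### The maximal Dyck path -/

section Dyck

variable (m n : ℕ)

theorem mem_vert_iff (k : Fin (m + n)) : k ∈ (maxDyckPath m n).vert ↔
    (maxDyckPoint m n (k + 1)).2 = (maxDyckPoint m n k).2 + 1 := by
  rw [LatticePath.vert, mem_filter]
  exact and_iff_right (mem_univ _)

theorem mem_vert_maxDyckPath (k : Fin (m + n)) :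
    k ∈ (maxDyckPath m n).vert ↔ (m : ℤ) ≤ n * (maxDyckPoint m n k).1 - m * (maxDyckPoint m n k).2 := by
  obtain ⟨h1, h2, h3, h4⟩ := maxDyckPoint_inv m n k (by omega)
  have : k ∈ (maxDyckPath m n).vert ↔ ((maxDyckPoint m n k).2 + 1 ≤ n ∧
      ((maxDyckPoint m n k).2 + 1) * m ≤ (maxDyckPoint m n k).1 * n) := by
    rw [mem_vert_iff, maxDyckPoint]
    split_ifs with h
    · simp [h]
    · exact iff_of_false (by simp) h
  rw [this]
  generalize maxDyckPoint m n k = P at *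
  have hk := k.isLt
  constructor
  · rintro ⟨-, h⟩
    zify at h
    linarith
  · intro h
    have h5 : (P.2 + 1) * m ≤ P.1 * n := by
      zify
      linarith
    refine ⟨?_, h5⟩
    -- At `y = n` the path is not yet finished, so `x < m` and a further North step would cross the
    -- diagonal: the bound by `n` is automatic.
    by_contra h6
    have h7 : P.2 = n := by omega
    have h8 : P.1 < m := by omega
    rw [h7] at h5
    nlinarith

theorem horiz_maxDyckPath : (maxDyckPath m n).horiz = (maxDyckPath m n).vertᶜ := by
  ext k
  rw [mem_compl, LatticePath.horiz, LatticePath.vert, mem_filter, mem_filter]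
  rcases (maxDyckPath m n).step k with h | h <;> simp [h]

theorem maxDyckPoint_succ_of_lt (k : Fin (m + n)) :
    maxDyckPoint m n (k + 1) = if k ∈ (maxDyckPath m n).vert then
      ((maxDyckPoint m n k).1, (maxDyckPoint m n k).2 + 1)
    else ((maxDyckPoint m n k).1 + 1, (maxDyckPoint m n k).2) := by
  have := (maxDyckPath m n).step k
  simp only [maxDyckPath, Fin.val_succ, Fin.val_castSucc] at this
  simp only [mem_vert_iff]
  rcases this with h | h <;> rw [h] <;> simp

/-- The position of the points of the maximal Dyck path relative to the main diagonal. -/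
def dyckHeight : ℤ → ℤ :=
  cyclicSum fun k : Fin (m + n) => if k ∈ (maxDyckPath m n).vert then -(m : ℤ) else n

/-- The path goes North exactly when the height is at least `m`, losing `m`, and East otherwise,
gaining `n`. Hence the height stays below `m + n`, and it is below `n` after a vertical edge. -/
theorem dyckHeight_natCast (hN : 0 < m + n) (k : ℕ) (hk : k < m + n) :
    dyckHeight m n k = n * (maxDyckPoint m n k).1 - m * (maxDyckPoint m n k).2 ∧
      dyckHeight m n k < m + n := by
  induction k with
  | zero =>
    have := cyclicSum_coe (fun k : Fin (m + n) => if k ∈ (maxDyckPath m n).vert then -(m : ℤ) else n)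
      ⟨0, hN⟩
    simp only [Fin.lt_def, Nat.not_lt_zero, if_false, sum_const_zero] at this
    rw [dyckHeight, this]
    simp [maxDyckPoint]
    omega
  | succ k ih =>
    obtain ⟨h1, h2⟩ := ih (by omega)
    have h3 := maxDyckPoint_succ_of_lt m n ⟨k, by omega⟩
    have h4 := cyclicSum_succ hN (fun k : Fin (m + n) =>
      if k ∈ (maxDyckPath m n).vert then -(m : ℤ) else n) k
    have h5 := edgeAt_coe hN ⟨k, by omega⟩
    have h6 := mem_vert_maxDyckPath m n ⟨k, by omega⟩
    simp only at h3 h5 h6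
    rw [← h1] at h6
    rw [h5, ← dyckHeight] at h4
    rw [h3]
    push_cast
    rw [h4]
    split_ifs with h7
    · push_cast
      constructor <;> linarith
    · rw [h6, not_le] at h7
      push_cast
      constructor <;> linarith

theorem card_vert_maxDyckPath : (maxDyckPath m n).vert.card = n := by
  have h : ∀ k, k ≤ m + n → ({i ∈ (maxDyckPath m n).vert | i.val < k} : Finset _).card =
      (maxDyckPoint m n k).2 := by
    intro k
    induction k with
    | zero => simp [maxDyckPoint]
    | succ k ih =>
      intro hk
      have h3 := maxDyckPoint_succ_of_lt m n ⟨k, by omega⟩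
      simp only at h3
      rw [h3]
      have ih := ih (by omega)
      split_ifs with h7
      · rw [← ih, ← card_insert_of_notMem (a := ⟨k, by omega⟩) (by simp)]
        dsimp only
        refine congrArg Finset.card (Finset.ext fun i => ?_)
        simp only [mem_filter, mem_insert, Fin.ext_iff]
        constructor
        · rintro ⟨h8, h9⟩
          rcases Nat.lt_or_ge i k with h10 | h10
          · exact Or.inr ⟨h8, h10⟩
          · exact Or.inl (by omega)
        · rintro (h8 | h8)
          · have : i = ⟨k, by omega⟩ := Fin.ext h8
            rw [this]
            exact ⟨h7, by simp⟩
          · exact ⟨h8.1, by omega⟩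
      · rw [← ih]
        refine congrArg Finset.card (Finset.ext fun i => ?_)
        simp only [mem_filter]
        refine and_congr_right fun h8 => ⟨fun h9 => ?_, fun h9 => by omega⟩
        by_contra h10
        have : i = ⟨k, by omega⟩ := Fin.ext (by simp only; omega)
        exact h7 (this ▸ h8)
  have h1 := h (m + n) le_rfl
  rw [filter_true_of_mem fun i _ => i.isLt] at h1
  have h2 := (maxDyckPath m n).finish
  simp only [maxDyckPath, Fin.val_last] at h2
  rw [h1, h2]

theorem card_compl_vert_maxDyckPath : (maxDyckPath m n).vertᶜ.card = m := by
  rw [card_compl, card_vert_maxDyckPath, Fintype.card_fin, Nat.add_sub_cancel]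

theorem sum_dyckHeight_steps :
    ∑ k : Fin (m + n), (if k ∈ (maxDyckPath m n).vert then -(m : ℤ) else n) = 0 := by
  rw [sum_ite, sum_const, sum_const, filter_mem_eq_inter, univ_inter, filter_notMem_eq_sdiff,
    ← compl_eq_univ_sdiff, card_vert_maxDyckPath, card_compl_vert_maxDyckPath]
  simp [mul_comm]

variable (hN : 0 < m + n)

theorem dyckHeight_succ (k : ℤ) : dyckHeight m n (k + 1) = dyckHeight m n k +
    if edgeAt hN k ∈ (maxDyckPath m n).vert then -(m : ℤ) else n :=
  cyclicSum_succ hN _ k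

include hN

theorem dyckHeight_edgeAt (k : ℤ) : dyckHeight m n (edgeAt hN k) = dyckHeight m n k := by
  obtain ⟨t, ht⟩ := exists_eq_add_mul hN k
  conv_rhs => rw [ht]
  rw [dyckHeight, cyclicSum_add_mul hN, sum_dyckHeight_steps m n, mul_zero, add_zero]

theorem dyckHeight_add_period (k : ℤ) :
    dyckHeight m n (k + (m + n : ℕ)) = dyckHeight m n k := by
  rw [dyckHeight, cyclicSum_add_period hN, sum_dyckHeight_steps m n, add_zero]

theorem dyckHeight_nonneg (k : ℤ) : 0 ≤ dyckHeight m n k := by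
  rw [← dyckHeight_edgeAt m n hN, (dyckHeight_natCast m n hN _ (edgeAt hN k).isLt).1, sub_nonneg]
  have := (maxDyckPoint_inv m n (edgeAt hN k) (by omega)).2.2.2
  zify at this
  linarith

theorem edgeAt_mem_vert (k : ℤ) :
    edgeAt hN k ∈ (maxDyckPath m n).vert ↔ m ≤ dyckHeight m n k := by
  rw [← dyckHeight_edgeAt m n hN, (dyckHeight_natCast m n hN _ (edgeAt hN k).isLt).1,
    mem_vert_maxDyckPath]

theorem dyckHeight_succ_lt (k : ℤ) (hk : edgeAt hN k ∈ (maxDyckPath m n).vert) :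
    dyckHeight m n (k + 1) < n := by
  rw [dyckHeight_succ m n hN, if_pos hk]
  have := (dyckHeight_natCast m n hN _ (edgeAt hN k).isLt).2
  rw [dyckHeight_edgeAt] at this
  omega

end Dyck

end GreedyRank2

namespace GreedyRank2

/-! ### Inverting the generating functions of the rows -/

open Finset

/-- For `a ≤ 0` the convention makes the left side vanish, in agreement with the exponent `-[a]₊ =
0`. -/
theorem binom_eq_choose_neg (a : ℤ) (k : ℕ) (hk : 0 < k) :
    (-1) ^ k * binom (a + k - 1) k = Ring.choose (-(a.toNat : ℤ)) k := by
  rw [Ring.choose_neg, binom]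
  rcases lt_or_ge 0 a with h | h
  · rw [if_pos (by omega), Int.toNat_of_nonneg h.le]
    obtain ⟨n, hn⟩ : ∃ n : ℕ, a + k - 1 = n := ⟨(a + k - 1).toNat, by omega⟩
    rw [hn, Ring.choose_natCast, Int.toNat_natCast]
    simp [Units.smul_def, Int.negOnePow]
  · rw [if_neg (by omega), Int.toNat_of_nonpos h]
    obtain ⟨k, rfl⟩ : ∃ j, k = j + 1 := ⟨k - 1, by omega⟩
    have := Ring.choose_natCast (R := ℤ) k (k + 1)
    rw [Nat.choose_succ_self] at this
    push_cast
    rw [show (0 : ℤ) + (k + 1) - 1 = k by ring, this]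
    simp

open Polynomial in
/-- The coefficients of `f / (1 + X) ^ [a]₊`. -/
theorem coeff_of_eq_one_add_X_pow_mul {f Q : ℤ[X]} {a : ℤ} (h : f = (1 + X) ^ a.toNat * Q) (p : ℕ) :
    Q.coeff p = f.coeff p -
      ∑ k ∈ Icc 1 p, (-1) ^ (k - 1) * f.coeff (p - k) * binom (a + k - 1) k := by
  -- Division by `(1 + X) ^ [a]₊` is multiplication by a binomial series; its constant term yields
  -- `f.coeff p`.
  have h1 : (Q : PowerSeries ℤ) = PowerSeries.binomialSeries ℤ (-(a.toNat : ℤ)) * f := by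
    rw [h, Polynomial.coe_mul, Polynomial.coe_pow, Polynomial.coe_add, Polynomial.coe_one,
      Polynomial.coe_X, ← mul_assoc]
    have := PowerSeries.binomialSeries_nat (R := ℤ) (A := ℤ) a.toNat
    rw [← this, ← PowerSeries.binomialSeries_add]
    simp
  rw [← Polynomial.coeff_coe, h1, PowerSeries.coeff_mul, Nat.sum_antidiagonal_eq_sum_range_succ_mk,
    sum_range_succ', add_comm, sub_eq_add_neg, ← sum_neg_distrib]
  congr 1
  · simp
  · rw [← Ico_add_one_right_eq_Icc, sum_Ico_eq_sum_range, Nat.add_sub_cancel]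
    refine sum_congr rfl fun k hk => ?_
    have := binom_eq_choose_neg a (k + 1) (by omega)
    rw [Polynomial.coeff_coe, PowerSeries.binomialSeries_coeff, ← this, add_comm 1 k,
      Nat.add_sub_cancel, pow_succ]
    simp only [smul_eq_mul, mul_one]
    ring

end GreedyRank2

namespace GreedyRank2

open Finset Polynomial

/-! ### Polynomials that expand in products of powers of `1 + X` and `1 + Y` -/

theorem coeff_coeff_swap (F : ℤ[X][X]) (p q : ℕ) :
    ((Bivariate.swap F).coeff p).coeff q = (F.coeff q).coeff p := by
  induction F using Polynomial.induction_on' with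
  | add f g hf hg => simp only [map_add, coeff_add, hf, hg]
  | monomial k f =>
    induction f using Polynomial.induction_on' with
    | add f g hf hg => simp only [map_add, coeff_add, hf, hg]
    | monomial l a =>
      rw [Bivariate.swap_monomial_monomial, coeff_monomial, coeff_monomial]
      split_ifs with h1 h2 h2 <;> simp [coeff_monomial, h1, h2]

theorem coeff_X_pow_mul_one_add_X_pow {R : Type*} [CommRing R] (p r p' : ℕ) :
    ((X : R[X]) ^ p * (1 + X) ^ r).coeff p' = if p ≤ p' then (r.choose (p' - p) : R) else 0 := by
  rw [coeff_X_pow_mul', coeff_one_add_X_pow]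

/-- The polynomial `X ^ p (1 + X) ^ r(q) Y ^ q (1 + Y) ^ μ(p)`. -/
noncomputable def standardPoly (μ r : ℕ → ℕ) (p q : ℕ) : ℤ[X][X] :=
  C (X ^ p * (1 + X) ^ r q) * (X ^ q * (1 + X) ^ μ p)

variable {μ r : ℕ → ℕ}

theorem swap_standardPoly (p q : ℕ) :
    Bivariate.swap (standardPoly μ r p q) = standardPoly r μ q p := by
  have h1 : Bivariate.swap (R := ℤ) (C X) = X := Bivariate.swap_X
  have h2 : Bivariate.swap (R := ℤ) X = C X := Bivariate.swap_Y
  simp only [standardPoly, map_mul, map_pow, map_add, map_one, h1, h2]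
  ring

theorem coeff_standardPoly (p q q' : ℕ) : (standardPoly μ r p q).coeff q' =
    if q ≤ q' then X ^ p * (1 + X) ^ r q * ((μ p).choose (q' - q) : ℤ[X]) else 0 := by
  rw [standardPoly, coeff_C_mul, coeff_X_pow_mul_one_add_X_pow]
  split_ifs <;> simp

theorem dvd_coeff_standardPoly (hr : Antitone r) (p q q' : ℕ) :
    (1 + X) ^ r q' ∣ (standardPoly μ r p q).coeff q' := by
  rw [coeff_standardPoly]
  split_ifs with h
  · exact Dvd.dvd.mul_right (Dvd.dvd.mul_left (pow_dvd_pow _ (hr h)) _) _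
  · exact dvd_zero _

/-- `X ^ p` and `(1 + X) ^ r q` are coprime, so both together divide row `q`. From column `p` on,
`μ` vanishes and the standard polynomials are just `X ^ i (1 + X) ^ r q Y ^ q`. -/
theorem mem_closure_of_vanish {F : ℤ[X][X]} (hrow : ∀ q, (1 + X) ^ r q ∣ F.coeff q) {p : ℕ}
    (hμ : ∀ i, p ≤ i → μ i = 0) (hv : ∀ i < p, (Bivariate.swap F).coeff i = 0) :
    F ∈ AddSubgroup.closure (Set.range fun i : ℕ × ℕ => standardPoly μ r i.1 i.2) := by
  rw [F.as_sum_support_C_mul_X_pow]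
  refine AddSubgroup.sum_mem _ fun q _ => ?_
  obtain ⟨Q, hQ⟩ := hrow q
  have h1 : (X : ℤ[X]) ^ p ∣ Q := by
    have hc : IsCoprime ((X : ℤ[X]) ^ p) ((1 + X) ^ r q) :=
      IsCoprime.pow ⟨-1, 1, by ring⟩
    refine hc.dvd_of_dvd_mul_left ?_
    rw [← hQ, X_pow_dvd_iff]
    intro i hi
    rw [← coeff_coeff_swap, hv i hi, coeff_zero]
  rw [hQ, Q.as_sum_support_C_mul_X_pow, mul_sum, map_sum, sum_mul]
  refine AddSubgroup.sum_mem _ fun i _ => ?_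
  by_cases hi : p ≤ i
  · have e : C ((1 + X) ^ r q * (C (Q.coeff i) * X ^ i)) * X ^ q =
        Q.coeff i • standardPoly μ r i q := by
      rw [standardPoly, hμ i hi, zsmul_eq_mul]
      simp only [map_mul, map_pow, map_add, map_one, pow_zero]
      have : (C (C (Q.coeff i)) : ℤ[X][X]) = ((Q.coeff i : ℤ) : ℤ[X][X]) := by simp
      rw [this]
      ring
    rw [e]
    exact AddSubgroup.zsmul_mem _ (AddSubgroup.subset_closure (Set.mem_range_self (i, q))) _
  · rw [X_pow_dvd_iff.1 h1 i (by omega)]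
    simp

/-- A polynomial whose rows and columns have the required divisibility is an integral combination
of the polynomials `standardPoly μ r p q`. -/
theorem mem_closure_standardPoly (hμ : Antitone μ) (hr : Antitone r) {p₀ : ℕ}
    (hμ₀ : ∀ i, p₀ ≤ i → μ i = 0) {F : ℤ[X][X]} (hrow : ∀ q, (1 + X) ^ r q ∣ F.coeff q)
    (hcol : ∀ p, (1 + X) ^ μ p ∣ (Bivariate.swap F).coeff p) :
    F ∈ AddSubgroup.closure (Set.range fun i : ℕ × ℕ => standardPoly μ r i.1 i.2) := by
  -- Columns are cleared one at a time: those before `p` already vanish, and `d` more remain before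
  -- `p₀`.
  suffices H : ∀ d p, p + d = p₀ → ∀ F : ℤ[X][X], (∀ q, (1 + X) ^ r q ∣ F.coeff q) →
      (∀ p, (1 + X) ^ μ p ∣ (Bivariate.swap F).coeff p) →
      (∀ i < p, (Bivariate.swap F).coeff i = 0) →
      F ∈ AddSubgroup.closure (Set.range fun i : ℕ × ℕ => standardPoly μ r i.1 i.2) from
    H p₀ 0 (by omega) F hrow hcol fun i hi => by omega
  intro d
  induction d with
  | zero =>
    rintro p rfl F hrow - hv
    exact mem_closure_of_vanish hrow hμ₀ hv
  | succ d ih =>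
    intro p hp F hrow hcol hv
    obtain ⟨k, hk⟩ := hcol p
    -- `G` has the same column `p` as `F`, nothing before it, and the same divisibilities, so `F -
    -- G` has one more vanishing column.
    set G : ℤ[X][X] := ∑ q ∈ k.support, k.coeff q • standardPoly μ r p q with hG
    have hGmem : G ∈ AddSubgroup.closure
        (Set.range fun i : ℕ × ℕ => standardPoly μ r i.1 i.2) :=
      AddSubgroup.sum_mem _ fun q _ =>
        AddSubgroup.zsmul_mem _ (AddSubgroup.subset_closure (Set.mem_range_self (p, q))) _
    have hcoeff : ∀ i, (Bivariate.swap G).coeff i =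
        ∑ q ∈ k.support, k.coeff q • (standardPoly r μ q p).coeff i := fun i => by
      simp only [hG, map_sum, map_zsmul, swap_standardPoly, finsetSum_coeff, coeff_smul]
    rw [← sub_add_cancel F G]
    refine AddSubgroup.add_mem _ (ih (p + 1) (by omega) _ (fun q => ?_) (fun i => ?_)
      fun i hi => ?_) hGmem
    · rw [coeff_sub]
      refine dvd_sub (hrow q) ?_
      simp only [hG, finsetSum_coeff, coeff_smul]
      exact dvd_sum fun q' _ => dvd_smul_of_dvd _ (dvd_coeff_standardPoly hr _ _ _)
    · rw [map_sub, coeff_sub, hcoeff]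
      exact dvd_sub (hcol i) (dvd_sum fun q' _ =>
        dvd_smul_of_dvd _ (dvd_coeff_standardPoly hμ _ _ _))
    · rw [map_sub, coeff_sub, hcoeff]
      simp only [coeff_standardPoly]
      rcases Nat.lt_succ_iff_lt_or_eq.1 hi with h | rfl
      · rw [hv i h, sum_eq_zero, sub_zero]
        intro q _
        rw [if_neg (by omega), smul_zero]
      · rw [hk, sub_eq_zero]
        conv_lhs => rw [k.as_sum_support_C_mul_X_pow, mul_sum]
        refine sum_congr rfl fun q _ => ?_
        simp [zsmul_eq_mul]
        ring

end GreedyRank2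

namespace GreedyRank2

open Finset Polynomial

/-! ### Generating functions of compatible pairs -/

section GeneratingFunctions

variable {α : Type*}

/-- A set splits into its part in `sh`, which decides `P`, and an arbitrary subset of `V \ sh`,
summed by the binomial theorem. -/
theorem sum_powerset_X_pow [DecidableEq α] {V sh : Finset α} (hsh : sh ⊆ V) (P : Finset α → Prop)
    [DecidablePred P] (hP : ∀ S ⊆ V, P S ↔ P (S ∩ sh)) :
    ∑ S ∈ V.powerset with P S, (X : ℤ[X]) ^ S.card =
      (1 + X) ^ (V \ sh).card * ∑ S ∈ sh.powerset with P S, X ^ S.card := by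
  have h := Finset.sum_pow_mul_eq_add_pow (X : ℤ[X]) 1 (V \ sh)
  simp only [one_pow, mul_one] at h
  rw [add_comm 1 X, ← h, sum_mul_sum, ← sum_product']
  have hd : ∀ S ⊆ V \ sh, ∀ T ⊆ sh, Disjoint S T := fun S hS T hT =>
    disjoint_of_subset_left hS (disjoint_of_subset_right hT sdiff_disjoint)
  refine sum_nbij' (fun S => (S \ sh, S ∩ sh)) (fun S => S.1 ∪ S.2) ?_ ?_ ?_ ?_ ?_
  · intro S hS
    simp only [mem_filter, mem_powerset, mem_product] at hS ⊢
    exact ⟨sdiff_subset_sdiff hS.1 le_rfl, inter_subset_right, (hP S hS.1).1 hS.2⟩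
  · rintro ⟨S, T⟩ hS
    simp only [mem_filter, mem_powerset, mem_product] at hS ⊢
    have hsub : S ∪ T ⊆ V := union_subset (hS.1.trans sdiff_subset) (hS.2.1.trans hsh)
    have hSsh : S ∩ sh = ∅ := disjoint_iff_inter_eq_empty.1 (hd S hS.1 sh le_rfl)
    refine ⟨hsub, (hP _ hsub).2 ?_⟩
    rw [union_inter_distrib_right, hSsh, empty_union, inter_eq_left.2 hS.2.1]
    exact hS.2.2
  · intro S _
    exact sdiff_union_inter S sh
  · rintro ⟨S, T⟩ hS
    simp only [mem_filter, mem_powerset, mem_product] at hS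
    have hSsh : Disjoint S sh := hd S hS.1 sh le_rfl
    ext1
    · simp only [union_sdiff_distrib, sdiff_eq_empty_iff_subset.2 hS.2.1, union_empty,
        sdiff_eq_self_of_disjoint hSsh]
    · simp only [union_inter_distrib_right, disjoint_iff_inter_eq_empty.1 hSsh, empty_union,
        inter_eq_left.2 hS.2.1]
  · intro S _
    rw [← pow_add]
    congr 1
    rw [add_comm, card_inter_add_card_sdiff]

theorem sum_pairs_X_pow [DecidableEq α] {H V : Finset α} (R : Finset α → Finset α → Prop)
    [∀ S T, Decidable (R S T)] (sh : Finset α → Finset α) {c : ℕ}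
    (hsh : ∀ S, sh S ⊆ V) (hcard : ∀ S ⊆ H, (V \ sh S).card = V.card - c * S.card)
    (hR : ∀ S ⊆ H, ∀ T ⊆ V, R S T ↔ R S (T ∩ sh S)) (q : ℕ) :
    ∑ S ∈ H.powerset ×ˢ V.powerset with R S.1 S.2 ∧ S.1.card = q, (X : ℤ[X]) ^ S.2.card =
      (1 + X) ^ (V.card - c * q) *
        ∑ S ∈ H.powerset ×ˢ V.powerset with (R S.1 S.2 ∧ S.1.card = q) ∧ S.2 ⊆ sh S.1,
          X ^ S.2.card := by
  rw [sum_filter, sum_filter, sum_product, sum_product, mul_sum]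
  refine sum_congr rfl fun S hS => ?_
  rw [mem_powerset] at hS
  by_cases hq : S.card = q
  · simp only [hq, and_true]
    rw [← sum_filter, sum_powerset_X_pow (hsh S) (R S) (hR S hS), hcard S hS, hq, ← sum_filter]
    congr 2
    ext T
    simp only [mem_filter, mem_powerset]
    exact ⟨fun h => ⟨h.1.trans (hsh S), h.2, h.1⟩, fun h => ⟨h.2.2, h.2.1⟩⟩
  · simp [hq]

/-- The generating function of a set of pairs. -/
noncomputable def pairPoly (C : Finset (Finset α × Finset α)) : ℤ[X][X] :=
  ∑ S ∈ C, Polynomial.C (X ^ S.2.card) * X ^ S.1.card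

/-- The inner variable marks `|S₂|` and the outer one `|S₁|`: rows have `|S₁|` fixed, and
`Bivariate.swap` gives the columns. -/
theorem coeff_pairPoly (C : Finset (Finset α × Finset α)) (q : ℕ) :
    (pairPoly C).coeff q = ∑ S ∈ C with S.1.card = q, X ^ S.2.card := by
  rw [pairPoly, finsetSum_coeff, sum_filter]
  refine sum_congr rfl fun S _ => ?_
  rw [coeff_C_mul, coeff_X_pow]
  simp [eq_comm]

theorem coeff_sum_X_pow {ι : Type*} (C : Finset ι) (w : ι → ℕ) (p : ℕ) :
    (∑ S ∈ C, (X : ℤ[X]) ^ w S).coeff p = ({S ∈ C | w S = p} : Finset ι).card := by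
  rw [finsetSum_coeff, card_filter]
  push_cast
  refine sum_congr rfl fun S _ => ?_
  rw [coeff_X_pow]
  simp [eq_comm]

theorem coeff_coeff_pairPoly (C : Finset (Finset α × Finset α)) (p q : ℕ) :
    ((pairPoly C).coeff q).coeff p =
      ({S ∈ C | S.1.card = q ∧ S.2.card = p} : Finset (Finset α × Finset α)).card := by
  rw [coeff_pairPoly, coeff_sum_X_pow, filter_filter]

theorem coeff_swap_pairPoly (C : Finset (Finset α × Finset α)) (p : ℕ) :
    (Bivariate.swap (pairPoly C)).coeff p = ∑ S ∈ C with S.2.card = p, X ^ S.1.card := by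
  ext q
  rw [coeff_coeff_swap, coeff_coeff_pairPoly, coeff_sum_X_pow, filter_filter]
  simp only [and_comm]

end GeneratingFunctions

/-! ### Rows and columns for the maximal Dyck path -/

section Pairs

variable {b c : ℕ} (m n : ℕ)

local notation "𝒱" => LatticePath.vert (maxDyckPath m n)

theorem compatible_iff_walkCompat (hb : 0 < b) (hc : 0 < c) (hN : 0 < m + n)
    {S₁ S₂ : Finset (Fin (m + n))} (h₁ : S₁ ⊆ 𝒱ᶜ) (h₂ : S₂ ⊆ 𝒱) :
    Compatible b c (maxDyckPath m n) S₁ S₂ ↔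
      WalkCompat (m + n) (walk₁ c 𝒱 S₁) (walk₂ b 𝒱 S₂) := by
  rw [← compatibleWalks_iff hN h₁ h₂, ← compatible_iff_walks hN hb hc h₁ h₂, Compatible,
    horiz_maxDyckPath]

theorem mem_compatiblePairs {S : Finset (Fin (m + n)) × Finset (Fin (m + n))} :
    S ∈ compatiblePairs b c (maxDyckPath m n) ↔
      (S.1 ⊆ 𝒱ᶜ ∧ S.2 ⊆ 𝒱) ∧ Compatible b c (maxDyckPath m n) S.1 S.2 := by
  rw [compatiblePairs, mem_filter, mem_product, mem_powerset, mem_powerset, horiz_maxDyckPath]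

theorem coeff_pairPoly_eq_mul (hb : 0 < b) (hc : 0 < c) (q : ℕ) :
    (pairPoly (compatiblePairs b c (maxDyckPath m n))).coeff q = (1 + X) ^ (n - c * q) *
      ∑ S ∈ compatiblePairs b c (maxDyckPath m n) with
        S.1.card = q ∧ S.2 ⊆ shadow₁ c 𝒱 S.1, X ^ S.2.card := by
  have h := sum_pairs_X_pow (H := 𝒱ᶜ) (V := 𝒱) (Compatible b c (maxDyckPath m n))
    (fun S => shadow₁ c 𝒱 S) (fun S => shadow₁_subset) (fun S hS => card_sdiff_shadow₁ hS)
    (fun S hS T hT => by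
      rcases Nat.eq_zero_or_pos (m + n) with h0 | hN
      · have : IsEmpty (Fin (m + n)) := by rw [h0]; infer_instance
        rw [Subsingleton.elim (T ∩ shadow₁ c 𝒱 S) T]
      · rw [compatible_iff_walkCompat m n hb hc hN hS hT,
          compatible_iff_walkCompat m n hb hc hN hS (inter_subset_left.trans hT),
          ← walkCompat_inter_shadow₁ hN hb hS hT]) q
  rw [card_vert_maxDyckPath] at h
  rw [coeff_pairPoly, compatiblePairs, horiz_maxDyckPath, filter_filter, filter_filter, h]
  simp only [and_assoc]

theorem sum_filter_swap {α β M : Type*} [AddCommMonoid M] (s : Finset α) (t : Finset β)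
    (P : α × β → Prop) [DecidablePred P] (f : α × β → M) :
    ∑ x ∈ s ×ˢ t with P x, f x = ∑ x ∈ t ×ˢ s with P x.swap, f x.swap := by
  rw [sum_filter, sum_filter, sum_product_right, sum_product]
  rfl

theorem coeff_swap_pairPoly_eq_mul (hb : 0 < b) (hc : 0 < c) (p : ℕ) :
    (Bivariate.swap (pairPoly (compatiblePairs b c (maxDyckPath m n)))).coeff p =
      (1 + X) ^ (m - b * p) *
      ∑ S ∈ compatiblePairs b c (maxDyckPath m n) with
        S.2.card = p ∧ S.1 ⊆ shadow₂ b 𝒱 S.2, X ^ S.1.card := by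
  have h := sum_pairs_X_pow (H := 𝒱) (V := 𝒱ᶜ) (fun S T => Compatible b c (maxDyckPath m n) T S)
    (fun S => shadow₂ b 𝒱 S) (fun S => shadow₂_subset) (fun S hS => card_sdiff_shadow₂ hS)
    (fun S hS T hT => by
      rcases Nat.eq_zero_or_pos (m + n) with h0 | hN
      · have : IsEmpty (Fin (m + n)) := by rw [h0]; infer_instance
        rw [Subsingleton.elim (T ∩ shadow₂ b 𝒱 S) T]
      · rw [compatible_iff_walkCompat m n hb hc hN hT hS,
          compatible_iff_walkCompat m n hb hc hN (inter_subset_left.trans hT) hS,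
          ← walkCompat_inter_shadow₂ hN hc hT hS]) p
  rw [card_compl_vert_maxDyckPath] at h
  rw [coeff_swap_pairPoly, compatiblePairs, horiz_maxDyckPath, filter_filter, filter_filter,
    sum_filter_swap (s := 𝒱ᶜ.powerset), sum_filter_swap (s := 𝒱ᶜ.powerset)]
  simp only [Prod.fst_swap, Prod.snd_swap, ← and_assoc]
  exact h

/-- A compatible pair `(S₁,S₂)` with `S₂` in the shadow of `S₁` and a compatible pair `(T₁,T₂)`
with `T₁` in the shadow of `T₂` do not have the same positive size. -/
theorem eq_zero_of_shadowed (hb : 0 < b) (hc : 0 < c)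
    {S T : Finset (Fin (m + n)) × Finset (Fin (m + n))}
    (hS : S ∈ compatiblePairs b c (maxDyckPath m n)) (hS' : S.2 ⊆ shadow₁ c 𝒱 S.1)
    (hT : T ∈ compatiblePairs b c (maxDyckPath m n)) (hT' : T.1 ⊆ shadow₂ b 𝒱 T.2)
    (h1 : S.1.card = T.1.card) (h2 : S.2.card = T.2.card) : S.1.card = 0 ∧ S.2.card = 0 := by
  rw [mem_compatiblePairs] at hS hT
  obtain ⟨⟨hS1, hS2⟩, hSc⟩ := hS
  obtain ⟨⟨hT1, hT2⟩, hTc⟩ := hT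
  by_contra hcon
  -- An empty `S.1` has empty shadow, so `S.2` would be empty too.
  have hSne : S.1.Nonempty := by
    rw [nonempty_iff_ne_empty]
    intro h0
    rw [h0, shadow₁_empty, subset_empty] at hS'
    exact hcon ⟨by rw [h0, card_empty], by rw [hS', card_empty]⟩
  have hTne : T.2.Nonempty := by
    rw [nonempty_iff_ne_empty]
    intro h0
    rw [h0, shadow₂_empty, subset_empty] at hT'
    exact hcon ⟨by rw [h1, hT', card_empty], by rw [h2, h0, card_empty]⟩
  have hm : 0 < m := by
    rw [← card_compl_vert_maxDyckPath m n]
    exact card_pos.2 (hSne.mono hS1)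
  have hn : 0 < n := by
    rw [← card_vert_maxDyckPath m n]
    exact card_pos.2 (hTne.mono hT2)
  have hN : 0 < m + n := by omega
  rw [compatible_iff_walkCompat m n hb hc hN hS1 hS2] at hSc
  rw [compatible_iff_walkCompat m n hb hc hN hT1 hT2] at hTc
  have e1 := card_shadow₂_lt hN (dyckHeight_succ m n hN) (dyckHeight_add_period m n hN)
    (dyckHeight_nonneg m n hN) hb hc hn hS1 hS2 (dyckHeight_succ_lt m n hN) hSc hS' hSne
  have e2 := card_shadow₁_lt hN (dyckHeight_succ m n hN) (dyckHeight_add_period m n hN)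
    (dyckHeight_nonneg m n hN) hb hc hm hT1 hT2
    (fun k hk => by rwa [edgeAt_mem_vert, not_le] at hk) hTc hT' hTne
  -- Equal cardinalities give equal shadow sizes, which makes `e1` and `e2` contradictory.
  have hs1 : (shadow₁ c 𝒱 S.1).card = (shadow₁ c 𝒱 T.1).card := by
    have h3 := card_sdiff_add_card_eq_card (shadow₁_subset (c := c) (V := 𝒱) (S₁ := S.1))
    have h4 := card_sdiff_add_card_eq_card (shadow₁_subset (c := c) (V := 𝒱) (S₁ := T.1))
    rw [card_sdiff_shadow₁ hS1] at h3
    rw [card_sdiff_shadow₁ hT1, ← h1] at h4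
    omega
  have hs2 : (shadow₂ b 𝒱 S.2).card = (shadow₂ b 𝒱 T.2).card := by
    have h3 := card_sdiff_add_card_eq_card (shadow₂_subset (b := b) (V := 𝒱) (S₂ := S.2))
    have h4 := card_sdiff_add_card_eq_card (shadow₂_subset (b := b) (V := 𝒱) (S₂ := T.2))
    rw [card_sdiff_shadow₂ hS2] at h3
    rw [card_sdiff_shadow₂ hT2, ← h2] at h4
    omega
  rw [hs1, hs2] at e1
  omega

end Pairs

end GreedyRank2

namespace GreedyRank2

open Finset Polynomial

/-! ### Laurent expansions -/

theorem x₁_ne_zero : x₁ ≠ 0 := posAtOne_x₁.ne_zero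

theorem x₂_ne_zero : x₂ ≠ 0 := posAtOne_x₂.ne_zero

theorem clusterVar_one (b c : ℕ) : clusterVar b c 1 = x₁ := by simp [clusterVar, clusterFwd]

theorem clusterVar_two (b c : ℕ) : clusterVar b c 2 = x₂ := by simp [clusterVar, clusterFwd]

theorem clusterVar_mem (b c : ℕ) (m : ℤ) : clusterVar b c m ∈ clusterAlgebra b c :=
  Subring.subset_closure (Set.mem_range_self m)

/-- The product is `y ^ a` for `a ≥ 0` and `x ^ (-a)` for `a ≤ 0`; with an exchange relation for `h`
it is a cluster monomial. -/
theorem zpow_mul_pow_toNat_mem {A : Subring RatFun} {x y z : RatFun} (hx : x ≠ 0) (hxA : x ∈ A)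
    (hy : y ∈ A) (h : x * y = z) (a : ℤ) : x ^ (-a) * z ^ a.toNat ∈ A := by
  rcases le_total 0 a with ha | ha
  · obtain ⟨n, rfl⟩ := Int.eq_ofNat_of_zero_le ha
    rw [← h, mul_pow, zpow_neg]
    simp only [zpow_natCast, Int.toNat_natCast]
    rw [inv_mul_cancel_left₀ (pow_ne_zero n hx)]
    exact pow_mem hy n
  · obtain ⟨n, hn⟩ := Int.eq_ofNat_of_zero_le (a := -a) (by omega)
    rw [Int.toNat_of_nonpos ha, hn, pow_zero, mul_one]
    simp only [zpow_natCast]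
    exact pow_mem hxA n

/-- The Laurent expansion with the given numerator. -/
noncomputable def laurent (b c : ℕ) (a₁ a₂ : ℤ) : ℤ[X][X] →+ RatFun :=
  (AddMonoidHom.mulLeft (x₁ ^ (-a₁) * x₂ ^ (-a₂))).comp
    (eval₂RingHom (eval₂RingHom (Int.castRingHom RatFun) (x₁ ^ b)) (x₂ ^ c)).toAddMonoidHom

theorem laurent_apply (b c : ℕ) (a₁ a₂ : ℤ) (F : ℤ[X][X]) :
    laurent b c a₁ a₂ F = x₁ ^ (-a₁) * x₂ ^ (-a₂) *
      eval₂ (eval₂RingHom (Int.castRingHom RatFun) (x₁ ^ b)) (x₂ ^ c) F := rfl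

/-- By `x₀ x₂ = x₁ ^ b + 1` and `x₁ x₃ = x₂ ^ c + 1`, the image is a power of `x₀` or `x₂` times a
power of `x₁` or `x₃`. -/
theorem laurent_standardPoly_mem (b c : ℕ) (a₁ a₂ : ℤ) (p q : ℕ) :
    laurent b c a₁ a₂ (standardPoly (fun p => (a₁ - b * p).toNat) (fun q => (a₂ - c * q).toNat) p q)
      ∈ clusterAlgebra b c := by
  have e1 := clusterVar_exchange b c 1
  have e2 := clusterVar_exchange b c 2
  rw [if_pos (by decide)] at e1
  rw [if_neg (by decide)] at e2
  norm_num at e1 e2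
  rw [clusterVar_one, clusterVar_two, mul_comm] at e1
  rw [clusterVar_one, clusterVar_two] at e2
  have m1 := clusterVar_mem b c 1
  have m2 := clusterVar_mem b c 2
  rw [clusterVar_one] at m1
  rw [clusterVar_two] at m2
  have h1 := zpow_mul_pow_toNat_mem x₂_ne_zero m2 (clusterVar_mem b c 0) e1 (a₂ - c * q)
  have h2 := zpow_mul_pow_toNat_mem x₁_ne_zero m1 (clusterVar_mem b c 3) e2 (a₁ - b * p)
  have e : laurent b c a₁ a₂
      (standardPoly (fun p => (a₁ - b * p).toNat) (fun q => (a₂ - c * q).toNat) p q) =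
      (x₂ ^ (-(a₂ - c * q)) * (x₁ ^ b + 1) ^ (a₂ - c * q).toNat) *
      (x₁ ^ (-(a₁ - b * p)) * (x₂ ^ c + 1) ^ (a₁ - b * p).toNat) := by
    rw [laurent_apply, standardPoly]
    simp only [eval₂_mul, eval₂_C, eval₂_pow, eval₂_add, eval₂_one, eval₂_X, coe_eval₂RingHom]
    rw [show -(a₂ - c * q) = -a₂ + (c * q : ℕ) by push_cast; ring,
      show -(a₁ - b * p) = -a₁ + (b * p : ℕ) by push_cast; ring,
      zpow_add₀ x₂_ne_zero, zpow_add₀ x₁_ne_zero, zpow_natCast, zpow_natCast, pow_mul, pow_mul,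
      add_comm (x₁ ^ b) 1, add_comm (x₂ ^ c) 1]
    ring
  rw [e]
  exact mul_mem h1 h2

theorem laurent_mem (b c : ℕ) (hb : 0 < b) (a₁ a₂ : ℤ) {F : ℤ[X][X]}
    (hrow : ∀ q : ℕ, (1 + X) ^ (a₂ - c * q).toNat ∣ F.coeff q)
    (hcol : ∀ p : ℕ, (1 + X) ^ (a₁ - b * p).toNat ∣ (Bivariate.swap F).coeff p) :
    laurent b c a₁ a₂ F ∈ clusterAlgebra b c := by
  have anti : ∀ (a : ℤ) (d : ℕ), Antitone fun q : ℕ => (a - d * q).toNat := fun a d q q' h => by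
    have : (d : ℤ) * q ≤ d * q' := by exact_mod_cast Nat.mul_le_mul_left d h
    dsimp only
    omega
  have h := mem_closure_standardPoly (anti a₁ b) (anti a₂ c) (p₀ := a₁.toNat) (fun i hi => by
    have : (i : ℤ) ≤ b * i := by exact_mod_cast Nat.le_mul_of_pos_left i hb
    omega) hrow hcol
  have hle : AddSubgroup.closure (Set.range fun i : ℕ × ℕ => standardPoly
      (fun p => (a₁ - b * p).toNat) (fun q => (a₂ - c * q).toNat) i.1 i.2) ≤
      (clusterAlgebra b c).toAddSubgroup.comap (laurent b c a₁ a₂) := by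
    rw [AddSubgroup.closure_le]
    rintro _ ⟨i, rfl⟩
    exact laurent_standardPoly_mem b c a₁ a₂ i.1 i.2
  exact hle h

theorem laurent_pairPoly {α : Type*} (b c : ℕ) (a₁ a₂ : ℤ) (C : Finset (Finset α × Finset α)) :
    laurent b c a₁ a₂ (pairPoly C) = x₁ ^ (-a₁) * x₂ ^ (-a₂) *
      ∑ S ∈ C, x₁ ^ (b * S.2.card) * x₂ ^ (c * S.1.card) := by
  rw [laurent_apply, pairPoly, eval₂_finsetSum]
  refine congrArg _ (sum_congr rfl fun S _ => ?_)
  simp only [eval₂_mul, eval₂_C, eval₂_pow, eval₂_X, coe_eval₂RingHom, pow_mul]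

/-- The coefficients of a pointed expansion are determined by its value. -/
theorem expansion_injective {b c : ℕ} (hb : 0 < b) (hc : 0 < c) {κ κ' : ℕ × ℕ →₀ ℤ}
    (h : κ.sum (fun pq n => (n : RatFun) * x₁ ^ (b * pq.1) * x₂ ^ (c * pq.2)) =
      κ'.sum (fun pq n => (n : RatFun) * x₁ ^ (b * pq.1) * x₂ ^ (c * pq.2))) : κ = κ' := by
  have key : ∀ κ : ℕ × ℕ →₀ ℤ,
      κ.sum (fun pq n => (n : RatFun) * x₁ ^ (b * pq.1) * x₂ ^ (c * pq.2)) =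
      algebraMap (MvPolynomial (Fin 2) ℚ) RatFun (κ.sum fun pq n => MvPolynomial.monomial
        (Finsupp.single 0 (b * pq.1) + Finsupp.single 1 (c * pq.2)) (n : ℚ)) := by
    intro κ
    rw [Finsupp.sum, Finsupp.sum, map_sum]
    refine sum_congr rfl fun pq _ => ?_
    rw [MvPolynomial.monomial_eq, Finsupp.prod_add_index' (by simp) (by simp [pow_add])]
    simp [x₁, x₂, mul_assoc]
  rw [key, key] at h
  have h' := IsFractionRing.injective (MvPolynomial (Fin 2) ℚ) RatFun h
  have hcoeff : ∀ (κ : ℕ × ℕ →₀ ℤ) (p q : ℕ), MvPolynomial.coeff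
      (Finsupp.single 0 (b * p) + Finsupp.single 1 (c * q)) (κ.sum fun pq n =>
        MvPolynomial.monomial (Finsupp.single (0 : Fin 2) (b * pq.1) +
          Finsupp.single 1 (c * pq.2)) (n : ℚ)) = κ (p, q) := by
    intro κ p q
    have hinj : ∀ pq : ℕ × ℕ, (Finsupp.single (0 : Fin 2) (b * pq.1) +
        Finsupp.single 1 (c * pq.2) = Finsupp.single 0 (b * p) + Finsupp.single 1 (c * q)) ↔
        pq = (p, q) := fun pq => by
      constructor
      · intro h
        have h0 := DFunLike.congr_fun h 0
        have h1 := DFunLike.congr_fun h 1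
        simp at h0 h1
        exact Prod.ext (h0.resolve_right hb.ne') (h1.resolve_right hc.ne')
      · rintro rfl
        rfl
    rw [Finsupp.sum, MvPolynomial.coeff_sum]
    simp only [MvPolynomial.coeff_monomial, hinj]
    rw [Finset.sum_ite_eq']
    split_ifs with hs
    · rfl
    · rw [Finsupp.notMem_support_iff.1 hs, Int.cast_zero]
  ext ⟨p, q⟩
  have := congrArg (MvPolynomial.coeff
      (Finsupp.single 0 (b * p) + Finsupp.single 1 (c * q))) h'
  rw [hcoeff, hcoeff] at this
  exact_mod_cast this

/-! ### The greedy elements -/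

theorem IsPointedWith.unique {b c : ℕ} (hb : 0 < b) (hc : 0 < c) {a₁ a₂ : ℤ} {x : RatFun}
    {κ κ' : ℕ × ℕ →₀ ℤ} (h : IsPointedWith b c a₁ a₂ x κ) (h' : IsPointedWith b c a₁ a₂ x κ') :
    κ = κ' := by
  refine expansion_injective hb hc ?_
  have := h.2.1.symm.trans h'.2.1
  exact mul_left_cancel₀ (mul_ne_zero (zpow_ne_zero _ x₁_ne_zero) (zpow_ne_zero _ x₂_ne_zero)) this

/-- Both sums at `(p, q)` involve only entries with smaller `p + q`. -/
theorem GreedyRecurrence.unique {b c : ℕ} {a₁ a₂ : ℤ} {κ κ' : ℕ × ℕ →₀ ℤ}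
    (h : GreedyRecurrence b c a₁ a₂ κ) (h' : GreedyRecurrence b c a₁ a₂ κ')
    (h0 : κ (0, 0) = κ' (0, 0)) : κ = κ' := by
  suffices H : ∀ d p q, p + q = d → κ (p, q) = κ' (p, q) from
    Finsupp.ext fun pq => H _ pq.1 pq.2 rfl
  intro d
  induction d using Nat.strong_induction_on with
  | _ d ih =>
    rintro p q rfl
    by_cases hpq : (p, q) = (0, 0)
    · rw [hpq, h0]
    · rw [h p q hpq, h' p q hpq]
      congr 1 <;> refine sum_congr rfl fun k hk => ?_ <;> rw [mem_Icc] at hk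
      · rw [ih (p - k + q) (by omega) _ _ rfl]
      · rw [ih (p + (q - k)) (by omega) _ _ rfl]

/-! ### The counts of compatible pairs are the greedy coefficients -/

section Combinatorial

variable (b c m n : ℕ)

/-- The numbers of compatible pairs of given sizes. -/
noncomputable def pairCount : ℕ × ℕ →₀ ℤ :=
  ∑ S ∈ compatiblePairs b c (maxDyckPath m n), Finsupp.single (S.2.card, S.1.card) 1

theorem pairCount_apply (p q : ℕ) : pairCount b c m n (p, q) =
    ({S ∈ compatiblePairs b c (maxDyckPath m n) | S.1.card = q ∧ S.2.card = p}.card : ℤ) := by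
  rw [pairCount, Finsupp.finsetSum_apply, card_filter]
  push_cast
  refine sum_congr rfl fun S _ => ?_
  rw [Finsupp.single_apply]
  refine if_congr ?_ rfl rfl
  rw [Prod.mk.injEq, and_comm]

theorem pairCount_eq_coeff (p q : ℕ) : pairCount b c m n (p, q) =
    ((pairPoly (compatiblePairs b c (maxDyckPath m n))).coeff q).coeff p := by
  rw [pairCount_apply, coeff_coeff_pairPoly]

theorem pairCount_zero : pairCount b c m n (0, 0) = 1 := by
  rw [pairCount_apply]
  have : ({S ∈ compatiblePairs b c (maxDyckPath m n) | S.1.card = 0 ∧ S.2.card = 0} :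
      Finset (Finset (Fin (m + n)) × Finset (Fin (m + n)))) = {(∅, ∅)} := by
    ext S
    simp only [mem_filter, mem_compatiblePairs, card_eq_zero, mem_singleton, Prod.ext_iff]
    constructor
    · exact fun h => h.2
    · intro h
      refine ⟨⟨?_, ?_⟩, h⟩
      · rw [h.1, h.2]
        exact ⟨empty_subset _, empty_subset _⟩
      · rw [h.1]
        exact fun u hu => absurd hu (notMem_empty u)
  rw [this]
  simp

theorem pairCount_sum : (pairCount b c m n).sum
    (fun pq k => (k : RatFun) * x₁ ^ (b * pq.1) * x₂ ^ (c * pq.2)) =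
    ∑ S ∈ compatiblePairs b c (maxDyckPath m n), x₁ ^ (b * S.2.card) * x₂ ^ (c * S.1.card) := by
  rw [pairCount, ← Finsupp.sum_finsetSum_index (by simp) (fun _ _ _ => by push_cast; ring)]
  exact sum_congr rfl fun S _ => by simp

variable {b c}

theorem toNat_sub_mul (a : ℤ) (d q : ℕ) : a.toNat - d * q = (a - d * q).toNat := by
  have : (d : ℤ) * q = (d * q : ℕ) := by push_cast; ring
  rw [this]
  omega

theorem greedyRecurrence_pairCount (hb : 0 < b) (hc : 0 < c) (a₁ a₂ : ℤ) :
    GreedyRecurrence b c a₁ a₂ (pairCount b c a₁.toNat a₂.toNat) := by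
  intro p q hpq
  have h1 := coeff_pairPoly_eq_mul a₁.toNat a₂.toNat hb hc q
  have h2 := coeff_swap_pairPoly_eq_mul a₁.toNat a₂.toNat hb hc p
  rw [toNat_sub_mul] at h1 h2
  generalize a₁.toNat = m at *
  generalize a₂.toNat = n at *
  have r1 := coeff_of_eq_one_add_X_pow_mul h1 p
  have r2 := coeff_of_eq_one_add_X_pow_mul h2 q
  simp only [coeff_coeff_swap] at r2
  simp only [← pairCount_eq_coeff] at r1 r2
  rw [coeff_sum_X_pow, filter_filter] at r1 r2
  -- By `r1` and `r2` the coefficient exceeds each argument of the maximum by a cardinality; it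
  -- remains to see that one of the two sets is empty.
  rcases Finset.eq_empty_or_nonempty ({S ∈ compatiblePairs b c (maxDyckPath m n) |
    (S.1.card = q ∧ S.2 ⊆ shadow₁ c (maxDyckPath m n).vert S.1) ∧ S.2.card = p} :
      Finset (Finset (Fin (m + n)) × Finset (Fin (m + n)))) with h3 | ⟨S, hS⟩
  · rw [h3, card_empty] at r1
    rw [max_eq_left] <;> omega
  · rcases Finset.eq_empty_or_nonempty ({S ∈ compatiblePairs b c (maxDyckPath m n) |
      (S.2.card = p ∧ S.1 ⊆ shadow₂ b (maxDyckPath m n).vert S.2) ∧ S.1.card = q} :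
        Finset (Finset (Fin (m + n)) × Finset (Fin (m + n)))) with h4 | ⟨T, hT⟩
    · rw [h4, card_empty] at r2
      rw [max_eq_right] <;> omega
    · rw [mem_filter] at hS hT
      obtain ⟨hS1, ⟨hS2, hS3⟩, hS4⟩ := hS
      obtain ⟨hT1, ⟨hT2, hT3⟩, hT4⟩ := hT
      have := eq_zero_of_shadowed m n hb hc hS1 hS3 hT1 hT3 (hS2.trans hT4.symm)
        (hS4.trans hT2.symm)
      exact absurd (Prod.ext (hS4.symm.trans this.2) (hS2.symm.trans this.1)) hpq

theorem isPointedWith_pairCount (hb : 0 < b) (hc : 0 < c) (a₁ a₂ : ℤ) :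
    IsPointedWith b c a₁ a₂ (x₁ ^ (-a₁) * x₂ ^ (-a₂) *
        ∑ S ∈ compatiblePairs b c (maxDyckPath a₁.toNat a₂.toNat),
          x₁ ^ (b * S.2.card) * x₂ ^ (c * S.1.card)) (pairCount b c a₁.toNat a₂.toNat) := by
  refine ⟨?_, by rw [pairCount_sum], pairCount_zero _ _ _ _⟩
  rw [← laurent_pairPoly]
  refine laurent_mem b c hb a₁ a₂ (fun q => ?_) fun p => ?_
  · rw [coeff_pairPoly_eq_mul _ _ hb hc, toNat_sub_mul]
    exact dvd_mul_right _ _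
  · rw [coeff_swap_pairPoly_eq_mul _ _ hb hc, toNat_sub_mul]
    exact dvd_mul_right _ _

end Combinatorial

end GreedyRank2

theorem theorem1p11 (b c : ℕ) (hb : 0 < b) (hc : 0 < c) (a₁ a₂ : ℤ) :
    (∃! x : GreedyRank2.RatFun, GreedyRank2.IsGreedyAt b c a₁ a₂ x) ∧
    ∀ x : GreedyRank2.RatFun, GreedyRank2.IsGreedyAt b c a₁ a₂ x →
      x = GreedyRank2.x₁ ^ (-a₁) * GreedyRank2.x₂ ^ (-a₂) *
        ∑ S ∈ GreedyRank2.compatiblePairs b c (GreedyRank2.maxDyckPath a₁.toNat a₂.toNat),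
          GreedyRank2.x₁ ^ (b * S.2.card) * GreedyRank2.x₂ ^ (c * S.1.card) ∧
      ∀ κ : ℕ × ℕ →₀ ℤ, GreedyRank2.IsPointedWith b c a₁ a₂ x κ →
        ∀ p q : ℕ, κ (p, q) =
          ({S ∈ GreedyRank2.compatiblePairs b c (GreedyRank2.maxDyckPath a₁.toNat a₂.toNat) |
            S.1.card = q ∧ S.2.card = p}.card : ℤ) := by
  have hP := GreedyRank2.isPointedWith_pairCount hb hc a₁ a₂
  have hG := GreedyRank2.greedyRecurrence_pairCount hb hc a₁ a₂
  have key : ∀ x κ, GreedyRank2.IsPointedWith b c a₁ a₂ x κ →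
      GreedyRank2.GreedyRecurrence b c a₁ a₂ κ →
      κ = GreedyRank2.pairCount b c a₁.toNat a₂.toNat := fun x κ h1 h2 =>
    h2.unique hG (h1.2.2.trans hP.2.2.symm)
  have hx : ∀ x, GreedyRank2.IsGreedyAt b c a₁ a₂ x →
      x = GreedyRank2.x₁ ^ (-a₁) * GreedyRank2.x₂ ^ (-a₂) *
        ∑ S ∈ GreedyRank2.compatiblePairs b c (GreedyRank2.maxDyckPath a₁.toNat a₂.toNat),
          GreedyRank2.x₁ ^ (b * S.2.card) * GreedyRank2.x₂ ^ (c * S.1.card) := by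
    rintro x ⟨κ, h1, h2⟩
    rw [h1.2.1, key x κ h1 h2]
    exact hP.2.1.symm
  refine ⟨⟨_, ⟨_, hP, hG⟩, hx⟩, fun x hxG => ⟨hx x hxG, fun κ hκ p q => ?_⟩⟩
  -- The recurrence is known only for `κ'`; uniqueness of the expansion of `x` identifies `κ` with
  -- it.
  obtain ⟨κ', h1, h2⟩ := hxG
  rw [hκ.unique hb hc h1, key x κ' h1 h2, GreedyRank2.pairCount_apply]
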